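/- Let $T$ be an $n$-dimensional simplex in a Euclidean space with ordered vertices $v_0,\dots,v_n$, oriented by this order, with barycentric coordinates $\lambda_0,\dots,\lambda_n$. Let $r\in\mathbb N_0$ and $0\le k\le n$. Notation. $A(r,n)$ is the set of multiindices $\alpha:\{0,\dots,n\}\to\mathbb N_0$ with $\sum_i\alpha(i)=r$; $[\alpha]=\{i:\alpha(i)>0\}$; $\lambda^\alpha=\prod_i\lambda_i^{\alpha(i)}$; $\alpha\pm p$ is $\alpha$ with $\alpha(p)$ changed by $\pm1$. $\Sigma(k,n)$ is the set of strictly ascending sequences $\sigma$ of length $k$ in $\{0,\dots,n\}$, with image $[\sigma]$; $\sigma^c$ is the strictly ascending sequence (of length $n-k+1$) with image the complement of $[\sigma]$; $\sigma+q$ and $\sigma-p$ are the strictly ascending sequences with images $[\sigma]\cup\{q\}$ and $[\sigma]\setminus\{p\}$. $\epsilon(\sigma,\rho)$ is the sign of the permutation that puts the concatenation of the disjoint sequences $\sigma,\rho$ in ascending order (a single index counts as a sequence of length $1$). $\lfloor\cdot\rfloor$ is the minimum of $[\alpha]$ or $[\sigma]$, with $\lfloor\emptyset\rfloor=\infty$.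 Put $\lambda_\sigma=\prod_{p\in[\sigma]}\lambda_p$, let $d\lambda_\sigma$ be the exterior product of the $d\lambda_{p}$, $p\in[\sigma]$, in ascending order ($d\lambda_\emptyset=1$), let $\phi_\rho=\sum_{p\in[\rho]}\epsilon(p,\rho-p)\lambda_p\,d\lambda_{\rho-p}$ be the Whitney form of a nonempty $\rho$, and let $\phi_T$ be the Whitney $n$-form of the sequence $0,1,\dots,n$. Let $\mathcal P_s\Lambda^k(T)$ be the complex span of all $\lambda^\alpha d\lambda_\sigma$ with $\alpha\in A(s,n)$, $\sigma\in\Sigma(k,n)$; let $\mathring{\mathcal P}_s\Lambda^k(T)$ be its subspace of forms whose pullbacks to all proper subsimplices of $T$ vanish; and, for $s\ge1$, let $\mathcal P^-_s\Lambda^{k}(T)$ be the complex span of all $\lambda^\alpha\phi_\rho$ with $\alpha\in A(s-1,n)$ and $\rho$ strictly ascending of length $k+1$. (i) For every family of complex numbers $\omega_{\alpha\sigma}$, $\alpha\in A(r,n)$, $\sigma\in\Sigma(k,n)$, $$\sum_{\alpha,\beta\in A(r,n)}\sum_{\sigma,\rho\in\Sigma(k,n)}\int_T\omega_{\alpha\sigma}\lambda^\alpha\lambda_{\sigma^c}d\lambda_\sigma\wedge\epsilon(\rho,\rho^c)\overline{\omega_{\beta\rho}}\lambda^\beta\phi_{\rho^c}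 =(-1)^k\sum_{\theta\in\Sigma(k+1,n)}\int_T\lambda_{\theta^c}\Big|\sum_{\alpha\in A(r,n)}\sum_{p\in[\theta]}\epsilon(p,\theta-p)\lambda^\alpha\lambda_p\,\omega_{\alpha,\theta-p}\Big|^2\phi_T .$$ (ii) This number is zero if and only if any one of the following equivalent conditions holds: (a) $\sum_{\alpha,\sigma}\epsilon(\sigma,\sigma^c)\omega_{\alpha\sigma}\lambda^\alpha\phi_{\sigma^c}=0$; (b) $\sum_{\alpha,\sigma}\omega_{\alpha\sigma}\lambda^\alpha\lambda_{\sigma^c}d\lambda_\sigma=0$; (c) $\omega_{\alpha\sigma}-\sum_{q\in[\sigma]\cap[\alpha]}\epsilon(\lfloor\sigma^c\rfloor,\sigma-q)\,\epsilon(q,\sigma-q)\,\omega_{\alpha+\lfloor\sigma^c\rfloor-q,\;\sigma+\lfloor\sigma^c\rfloor-q}=0$ for all $\alpha\in A(r,n)$, $\sigma\in\Sigma(k,n)$ with $\lfloor\alpha\rfloor\ge\lfloor\sigma^c\rfloor$; (d) $\sum_{p\in[\theta]\cap[\beta]}\epsilon(\theta-p,p)\,\omega_{\beta-p,\theta-p}=0$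 for all $\beta\in A(r+1,n)$, $\theta\in\Sigma(k+1,n)$. (iii) The bilinear form $(\omega,\eta)\mapsto\int_T\omega\wedge\eta$ on $\mathring{\mathcal P}_{r+n-k+1}\Lambda^k(T)\times\mathcal P^-_{r+1}\Lambda^{n-k}(T)$ is non-degenerate (in both arguments). -/

import Mathlib

open MeasureTheory

noncomputable section

namespace BaryForms

/-! ### Multiindices, alternator indices and signs -/

/-- `A(r,n)`: multiindices `α : {0,…,n} → ℕ` with `|α| = r`. -/
abbrev MultiIdx (r n : ℕ) : Type := {α : Fin (n + 1) → ℕ // ∑ i, α i = r}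

instance (r n : ℕ) : Fintype (MultiIdx r n) :=
  Fintype.subtype (Finset.piAntidiag Finset.univ r) (by simp)

/-- The support `[α]`. -/
def MultiIdx.supp {r n : ℕ} (α : MultiIdx r n) : Finset (Fin (n + 1)) :=
  Finset.univ.filter fun i => 0 < α.1 i

/-- `α + p`. -/
def MultiIdx.add {r n : ℕ} (α : MultiIdx r n) (p : Fin (n + 1)) : MultiIdx (r + 1) n :=
  ⟨Function.update α.1 p (α.1 p + 1), by
    have h := α.2
    rw [← Finset.add_sum_erase _ _ (Finset.mem_univ p)] at h ⊢
    rw [Finset.sum_congr rfl fun i hi => Function.update_of_ne (Finset.ne_of_mem_erase hi) _ _]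
    simp only [Function.update_self]
    omega⟩

/-- `β - p`, for `p ∈ [β]`. -/
def MultiIdx.sub {r n : ℕ} (β : MultiIdx (r + 1) n) (p : Fin (n + 1)) (hp : p ∈ β.supp) :
    MultiIdx r n :=
  ⟨Function.update β.1 p (β.1 p - 1), by
    have h := β.2
    have h0 : 0 < β.1 p := by simpa [MultiIdx.supp] using hp
    rw [← Finset.add_sum_erase _ _ (Finset.mem_univ p)] at h ⊢
    rw [Finset.sum_congr rfl fun i hi => Function.update_of_ne (Finset.ne_of_mem_erase hi) _ _]
    simp only [Function.update_self]
    omega⟩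

theorem MultiIdx.mem_supp_add {r n : ℕ} (α : MultiIdx r n) (p q : Fin (n + 1))
    (hq : q ∈ α.supp) : q ∈ (α.add p).supp := by
  have h0 : 0 < α.1 q := by simpa [MultiIdx.supp] using hq
  refine Finset.mem_filter.2 ⟨Finset.mem_univ _, ?_⟩
  change 0 < Function.update α.1 p (α.1 p + 1) q
  rw [Function.update_apply]
  split <;> omega

/-- Strictly ascending sequences of length `k` in `{0,…,n}`, encoded by their images
(the sequence is recovered as the increasing enumeration of the image).
Thus `Σ(k,n)` is `AltIdx k n` and `Σ₀(l,n)` is `AltIdx (l + 1) n`. -/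
abbrev AltIdx (k n : ℕ) : Type := {s : Finset (Fin (n + 1)) // s.card = k}

/-- The complementary index `σᶜ ∈ Σ₀(n-k,n)` of `σ ∈ Σ(k,n)`. -/
def AltIdx.compl {k l n : ℕ} (hkl : k + l = n) (σ : AltIdx k n) : AltIdx (l + 1) n :=
  ⟨σ.1ᶜ, by
    rw [Finset.card_compl, σ.2, Fintype.card_fin]
    omega⟩

/-- `θ - p`, for `p ∈ [θ]`. -/
def AltIdx.sub {k n : ℕ} (θ : AltIdx (k + 1) n) (p : Fin (n + 1)) (hp : p ∈ θ.1) :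
    AltIdx k n :=
  ⟨θ.1.erase p, by rw [Finset.card_erase_of_mem hp, θ.2]; rfl⟩

/-- `σ + q`, for `q ∉ [σ]`. -/
def AltIdx.add {k n : ℕ} (σ : AltIdx k n) (q : Fin (n + 1)) (hq : q ∉ σ.1) :
    AltIdx (k + 1) n :=
  ⟨insert q σ.1, by rw [Finset.card_insert_of_notMem hq, σ.2]⟩

/-- The minimal element of `σᶜ`; the complement is never empty since `k ≤ n`. -/
def AltIdx.minCompl {k l n : ℕ} (hkl : k + l = n) (σ : AltIdx k n) : Fin (n + 1) :=
  (σ.compl hkl).1.min' (Finset.card_pos.1 (by rw [(σ.compl hkl).2]; omega))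

theorem AltIdx.minCompl_notMem {k l n : ℕ} (hkl : k + l = n) (σ : AltIdx k n) :
    σ.minCompl hkl ∉ σ.1 :=
  Finset.mem_compl.1 ((σ.compl hkl).1.min'_mem _)

/-- The signum of the permutation that orders a sequence in ascending order. -/
def sortSign {n : ℕ} (L : List (Fin (n + 1))) : ℤ :=
  (Equiv.Perm.sign (Tuple.sort L.get) : ℤ)

/-- The strictly ascending sequence with image `s`. -/
def ascending {n : ℕ} (s : Finset (Fin (n + 1))) : List (Fin (n + 1)) :=
  s.sort (· ≤ ·)

/-- `ε(σ,ρ)`: the sign ordering the sequence `σ` followed by `ρ`. -/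
def eps {n : ℕ} (s t : Finset (Fin (n + 1))) : ℤ :=
  sortSign (ascending s ++ ascending t)

/-! ### Simplices, barycentric coordinates and differential forms -/

section Simplex

variable {V : Type*} [AddCommGroup V] [Module ℝ V] {n : ℕ}

/-- The point set of the simplex `T`: the convex hull of its vertices. -/
abbrev Carrier (T : Affine.Simplex ℝ V n) : Set V := convexHull ℝ (Set.range T.points)

/-- The affine hull of the simplex. -/
abbrev Hull (T : Affine.Simplex ℝ V n) : AffineSubspace ℝ V :=
  affineSpan ℝ (Set.range T.points)

/-- The tangent space of the simplex. -/
abbrev Tangent (T : Affine.Simplex ℝ V n) : Submodule ℝ V := (Hull T).direction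

/-- The vertices as an affine basis of the affine hull. -/
def vertexBasis (T : Affine.Simplex ℝ V n) : AffineBasis (Fin (n + 1)) ℝ (Hull T) where
  toFun := (T.restrict (Hull T) le_rfl).points
  ind' := (T.restrict (Hull T) le_rfl).independent
  tot' := by
    convert affineSpan_coe_preimage_eq_top (k := ℝ) (Set.range T.points) using 2
    ext x
    simp [Subtype.ext_iff]

/-- The inclusion of the simplex into its affine hull. -/
def toHull (T : Affine.Simplex ℝ V n) (x : Carrier T) : Hull T :=
  ⟨x.1, convexHull_subset_affineSpan _ x.2⟩

/-- The barycentric coordinate `λᵢ` as a function on `T`. -/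
def lam (T : Affine.Simplex ℝ V n) (i : Fin (n + 1)) (x : Carrier T) : ℝ :=
  (vertexBasis T).coord i (toHull T x)

/-- The barycentric polynomial `λ^α`. -/
def lamPow (T : Affine.Simplex ℝ V n) {r : ℕ} (α : MultiIdx r n) (x : Carrier T) : ℝ :=
  ∏ i, lam T i x ^ α.1 i

/-- The product `λ_s` of the `λᵢ` with `i ∈ s`. -/
def lamProd (T : Affine.Simplex ℝ V n) (s : Finset (Fin (n + 1))) (x : Carrier T) : ℝ :=
  ∏ i ∈ s, lam T i x

/-- Complex differential `k`-forms over `T`: each point of `T` is assigned an alternating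
`k`-form on the tangent space of `T`. All form spaces below are spanned by polynomial forms. -/
abbrev Form (T : Affine.Simplex ℝ V n) (k : ℕ) : Type _ :=
  Carrier T → (Tangent T) [⋀^Fin k]→ₗ[ℝ] ℂ

/-- Product of a function and a form. -/
def fmul {T : Affine.Simplex ℝ V n} {k : ℕ} (f : Carrier T → ℝ) (ω : Form T k) : Form T k :=
  fun x => f x • ω x

/-- The exterior product of alternating forms (the signed sum over shuffles). -/
def altWedge {M : Type*} [AddCommGroup M] [Module ℝ M] {k l : ℕ}
    (a : M [⋀^Fin k]→ₗ[ℝ] ℂ) (b : M [⋀^Fin l]→ₗ[ℝ] ℂ) : M [⋀^Fin (k + l)]→ₗ[ℝ] ℂ :=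
  ((LinearMap.mul' ℝ ℂ).compAlternatingMap (a.domCoprod b)).domDomCongr finSumFinEquiv

/-- The exterior product of differential forms. -/
def wedge {T : Affine.Simplex ℝ V n} {k l : ℕ} (ω : Form T k) (η : Form T l) :
    Form T (k + l) :=
  fun x => altWedge (ω x) (η x)

/-- The `1`-form `dλᵢ`. Its value at every point is the derivative, that is, the linear part,
of the affine function `λᵢ`. -/
def dlam (T : Affine.Simplex ℝ V n) (i : Fin (n + 1)) : Form T 1 :=
  fun _ => AlternatingMap.ofSubsingleton ℝ (Tangent T) ℂ (0 : Fin 1)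
    (Complex.ofRealCLM.toLinearMap ∘ₗ ((vertexBasis T).coord i).linear)

/-- `dλ_{s 0} ∧ … ∧ dλ_{s (k-1)}`, and `1` for the empty sequence. -/
def dlamSeq (T : Affine.Simplex ℝ V n) : (k : ℕ) → (Fin k → Fin (n + 1)) → Form T k
  | 0, _ => fun _ => AlternatingMap.constOfIsEmpty ℝ (Tangent T) (Fin 0) (1 : ℂ)
  | k + 1, s => wedge (dlamSeq T k fun i => s i.castSucc) (dlam T (s (Fin.last k)))

/-- The barycentric alternator `dλ_σ`. -/
def dlamAlt (T : Affine.Simplex ℝ V n) {k : ℕ} (σ : AltIdx k n) : Form T k :=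
  dlamSeq T k (σ.1.orderEmbOfFin σ.2)

/-- The Whitney form `φ_ρ = ∑_{p ∈ [ρ]} ε(p, ρ - p) λ_p dλ_{ρ - p}`. -/
def whitney (T : Affine.Simplex ℝ V n) {l : ℕ} (ρ : AltIdx (l + 1) n) : Form T l :=
  ∑ p : ρ.1, eps {p.1} (ρ.1.erase p.1) • fmul (lam T p.1) (dlamAlt T (ρ.sub p.1 p.2))

/-- The Whitney form `φ_T` of the full index set, an `n`-form. -/
def whitneyTop (T : Affine.Simplex ℝ V n) : Form T n :=
  whitney T ⟨Finset.univ, by simp⟩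

/-! ### Traces and finite element spaces -/

theorem face_range_subset (T : Affine.Simplex ℝ V n) {m : ℕ} {fs : Finset (Fin (n + 1))}
    (h : fs.card = m + 1) : Set.range (T.face h).points ⊆ Set.range T.points := by
  rintro _ ⟨i, rfl⟩
  rw [Affine.Simplex.face_points]
  exact Set.mem_range_self _

/-- The trace of a form onto the subsimplex spanned by the vertices in `fs`: the pullback
along the inclusion. -/
def trace (T : Affine.Simplex ℝ V n) {k m : ℕ} {fs : Finset (Fin (n + 1))}
    (h : fs.card = m + 1) (ω : Form T k) : Form (T.face h) k :=
  fun x => (ω ⟨x.1, convexHull_mono (face_range_subset T h) x.2⟩).compLinearMap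
    (Submodule.inclusion
      (AffineSubspace.direction_le (affineSpan_mono ℝ (face_range_subset T h))))

/-- `P_r Λ^k(T)`. -/
def polyForms (T : Affine.Simplex ℝ V n) (r k : ℕ) : Submodule ℂ (Form T k) :=
  Submodule.span ℂ {ω | ∃ (α : MultiIdx r n) (σ : AltIdx k n),
    ω = fmul (lamPow T α) (dlamAlt T σ)}

/-- `P⁻_r Λ^k(T)`, spanned by `λ^α φ_ρ` with `|α| = r - 1`. -/
def whitneyForms (T : Affine.Simplex ℝ V n) (r k : ℕ) : Submodule ℂ (Form T k) :=
  Submodule.span ℂ {ω | ∃ s : ℕ, s + 1 = r ∧ ∃ (α : MultiIdx s n) (ρ : AltIdx (k + 1) n),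
    ω = fmul (lamPow T α) (whitney T ρ)}

/-- The forms in `P_r Λ^k(T)` whose traces on all proper subsimplices vanish. -/
def polyForms₀ (T : Affine.Simplex ℝ V n) (r k : ℕ) : Submodule ℂ (Form T k) where
  carrier := {ω | ω ∈ polyForms T r k ∧
    ∀ (m : ℕ) (fs : Finset (Fin (n + 1))) (h : fs.card = m + 1), fs ≠ Finset.univ →
      trace T h ω = 0}
  zero_mem' := ⟨zero_mem _, fun _ _ _ _ => rfl⟩
  add_mem' := by
    rintro a b ⟨ha, ha'⟩ ⟨hb, hb'⟩
    refine ⟨add_mem ha hb, fun m fs h hfs => ?_⟩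
    have : trace T h (a + b) = trace T h a + trace T h b := rfl
    rw [this, ha' m fs h hfs, hb' m fs h hfs, add_zero]
  smul_mem' := by
    rintro c a ⟨ha, ha'⟩
    refine ⟨Submodule.smul_mem _ c ha, fun m fs h hfs => ?_⟩
    have : trace T h (c • a) = c • trace T h a := rfl
    rw [this, ha' m fs h hfs, smul_zero]

/-! ### Integration -/

/-- The reference simplex `{t ∈ ℝⁿ | tᵢ ≥ 0, ∑ tᵢ ≤ 1}`. -/
def refSimplex (n : ℕ) : Set (Fin n → ℝ) := {t | (∀ i, 0 ≤ t i) ∧ ∑ i, t i ≤ 1}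

/-- The edge vector `v_{i+1} - v_0`. -/
def edge (T : Affine.Simplex ℝ V n) (i : Fin n) : Tangent T :=
  ⟨T.points i.succ - T.points 0,
    AffineSubspace.vsub_mem_direction (mem_affineSpan ℝ (Set.mem_range_self _))
      (mem_affineSpan ℝ (Set.mem_range_self _))⟩

/-- The affine parametrization `t ↦ v_0 + ∑ tᵢ (v_{i+1} - v_0)` of `T`. -/
def param (T : Affine.Simplex ℝ V n) (t : refSimplex n) : Carrier T :=
  ⟨T.points 0 + ∑ i, t.1 i • (T.points i.succ - T.points 0), by
    obtain ⟨t, ht0, ht1⟩ := t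
    have h := (convex_convexHull ℝ (Set.range T.points)).sum_mem (t := Finset.univ)
      (w := (Fin.cons (1 - ∑ i, t i) t : Fin (n + 1) → ℝ)) (z := T.points)
      (by
        intro i _
        refine Fin.cases ?_ (fun j => ?_) i
        · simpa using ht1
        · simpa using ht0 j)
      (by simp [Fin.sum_univ_succ])
      (fun i _ => subset_convexHull ℝ _ (Set.mem_range_self i))
    convert h using 1
    simp only [Fin.sum_univ_succ, Fin.cons_zero, Fin.cons_succ, smul_sub,
      Finset.sum_sub_distrib, sub_smul, one_smul, Finset.sum_smul]
    abel⟩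

/-- The integral `∫_T ω` of a form of top degree `m = n`, for the orientation of `T` given by
the order of the vertices: the Lebesgue integral over the reference simplex of the pullback of
`ω` under `param T`. -/
def integral (T : Affine.Simplex ℝ V n) {m : ℕ} (hm : m = n) (ω : Form T m) : ℂ :=
  ∫ t : refSimplex n, ω (param T t) (fun i => edge T (Fin.cast hm i))
    ∂(Measure.comap Subtype.val volume)

/-! ### The pairing -/

/-- The form `∑ ω_{ασ} λ^α λ_{σᶜ} dλ_σ`. -/
def bubbleSum (T : Affine.Simplex ℝ V n) {r k : ℕ} (ω : MultiIdx r n → AltIdx k n → ℂ) :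
    Form T k :=
  ∑ α, ∑ σ, ω α σ • fmul (lamPow T α) (fmul (lamProd T σ.1ᶜ) (dlamAlt T σ))

/-- The form `∑ ε(σ,σᶜ) ω_{ασ} λ^α φ_{σᶜ}`. -/
def whitneySum (T : Affine.Simplex ℝ V n) {r k l : ℕ} (hkl : k + l = n)
    (ω : MultiIdx r n → AltIdx k n → ℂ) : Form T l :=
  ∑ α, ∑ σ, ((eps σ.1 σ.1ᶜ : ℂ) * ω α σ) • fmul (lamPow T α) (whitney T (σ.compl hkl))

/-- `∑_{α,β} ∑_{σ,ρ} ∫_T ω_{ασ} λ^α λ_{σᶜ} dλ_σ ∧ ε(ρ,ρᶜ) conj(ω_{βρ}) λ^β φ_{ρᶜ}`. -/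
def pairingSum (T : Affine.Simplex ℝ V n) {r k l : ℕ} (hkl : k + l = n)
    (ω : MultiIdx r n → AltIdx k n → ℂ) : ℂ :=
  ∑ α : MultiIdx r n, ∑ β : MultiIdx r n, ∑ σ : AltIdx k n, ∑ ρ : AltIdx k n,
    integral T hkl (wedge
      (ω α σ • fmul (lamPow T α) (fmul (lamProd T σ.1ᶜ) (dlamAlt T σ)))
      (((eps ρ.1 ρ.1ᶜ : ℂ) * starRingEnd ℂ (ω β ρ)) •
        fmul (lamPow T β) (whitney T (ρ.compl hkl))))

/-- `∑_α ∑_{p ∈ [θ]} ε(p,θ-p) λ^α λ_p ω_{α,θ-p}` as a function on `T`. -/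
def thetaSum (T : Affine.Simplex ℝ V n) {r k : ℕ} (ω : MultiIdx r n → AltIdx k n → ℂ)
    (θ : AltIdx (k + 1) n) (x : Carrier T) : ℂ :=
  ∑ α : MultiIdx r n, ∑ p : θ.1,
    (eps {p.1} (θ.1.erase p.1) : ℂ) * lamPow T α x * lam T p.1 x * ω α (θ.sub p.1 p.2)

end Simplex

/-- The condition
`ω_{ασ} - ∑_{q ∈ [σ]∩[α]} ε(⌊σᶜ⌋,σ-q) ε(q,σ-q) ω_{α+⌊σᶜ⌋-q, σ+⌊σᶜ⌋-q} = 0`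
for all `α`, `σ` with `⌊α⌋ ≥ ⌊σᶜ⌋`, where `⌊·⌋` is the minimum and `⌊∅⌋ = ∞`. -/
def MinCondition {r k l n : ℕ} (hkl : k + l = n) (ω : MultiIdx r n → AltIdx k n → ℂ) : Prop :=
  ∀ (α : MultiIdx r n) (σ : AltIdx k n), (σ.1ᶜ).min ≤ α.supp.min →
    ω α σ - ∑ q : (σ.1 ∩ α.supp : Finset (Fin (n + 1))),
      (eps {σ.minCompl hkl} (σ.1.erase q.1) : ℂ) * (eps {q.1} (σ.1.erase q.1) : ℂ) *
        ω ((α.add (σ.minCompl hkl)).sub q.1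
            (α.mem_supp_add _ _ (Finset.mem_inter.1 q.2).2))
          ((σ.add (σ.minCompl hkl) (σ.minCompl_notMem hkl)).sub q.1
            (Finset.mem_insert_of_mem (Finset.mem_inter.1 q.2).1)) = 0

/-- The condition `∑_{p ∈ [θ]∩[β]} ε(θ-p,p) ω_{β-p,θ-p} = 0` for all `β ∈ A(r+1,n)` and
`θ ∈ Σ(k+1,n)`. -/
def CycleCondition {r k n : ℕ} (ω : MultiIdx r n → AltIdx k n → ℂ) : Prop :=
  ∀ (β : MultiIdx (r + 1) n) (θ : AltIdx (k + 1) n),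
    ∑ p : (θ.1 ∩ β.supp : Finset (Fin (n + 1))),
      (eps (θ.1.erase p.1) {p.1} : ℂ) *
        ω (β.sub p.1 (Finset.mem_inter.1 p.2).2) (θ.sub p.1 (Finset.mem_inter.1 p.2).1) = 0

end BaryForms

end

/-! Everything is reduced to Koszul operators on families of polynomials indexed by finite sets. A
coefficient family becomes $a_\sigma=\sum_\alpha\omega_{\alpha\sigma}X^\alpha$. Two operators act on
such families: $(Ka)_\theta=\sum_{p\in\theta}\pm X_p a_{\theta-p}$ (`kos` with `mulX`) and its
analogue $(K_1c)_\theta=\sum_{p\in\theta}\pm c_{\theta-p}$ without the variables (`kos` with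
`unitOp`).

Since $\sum_p d\lambda_p=0$ is the relation behind the redundancy of the $d\lambda_s$, a form $\sum
c_s\,d\lambda_s$ depends only on $K_1c$, whose entries are values on edges of subsimplices
(`altSum_eq_zero`, `altSum_vec`). For the bubble form, $(K_1c)_\theta=X_{\theta^c}(Ka)_\theta$
(`kos_unitOp_bubbleCoef`). In the Whitney form the coefficient of $d\lambda_{\theta^c}$ is
$\pm(Ka)_\theta$ (`whitneySum_eq_polyForm`). The product of the two therefore integrates to
$(-1)^k\sum_\theta\int\lambda_{\theta^c}(Ka)_\theta(Kb)_\theta$ (`pairing_bubble_whitney`), and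
taking $b$ conjugate to $a$ gives the sum of squares in (i).

The number vanishes exactly when $Ka=0$: the weights are positive inside $T$, and a homogeneous
polynomial vanishing there is zero (`kos_eq_zero_of_pairingSum_eq_zero`). Condition (d) is $Ka=0$
read off by coefficients. Condition (c) selects some of these coefficients, and the others follow
from $K^2=0$ (`cycleCondition_of_minCondition`).

For (iii), both spaces are images of coefficient families, so testing a form against the partner
with conjugate coefficients suffices. The real content is that every form with vanishing traces is a
bubble sum. Vanishing traces make $(K_1c)_\theta$ divisible by $X_{\theta^c}$. The quotients $G$
satisfy $KG=0$ because $K_1^2=0$, and Euler's identity gives $G=Ka$ (`exists_kos_mulX_eq`,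
`exists_bubbleCoef`). -/

namespace BaryForms

/-! ### Signs -/

/-- The sign `(-1)^#{i ∈ s | i < p}` of moving `p` into its place among the elements of `s`. -/
def sg {ι : Type*} [LinearOrder ι] (p : ι) (s : Finset ι) : ℤ :=
  (-1) ^ (s.filter (· < p)).card

section Sg

variable {ι : Type*} [LinearOrder ι]

theorem sg_mul_self (p : ι) (s : Finset ι) : sg p s * sg p s = 1 := by
  unfold sg
  rw [← mul_pow]
  simp

theorem sg_empty (p : ι) : sg p ∅ = 1 := by simp [sg]

theorem sg_erase_self (p : ι) (s : Finset ι) : sg p (s.erase p) = sg p s := by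
  unfold sg
  congr 2
  ext i
  simp only [Finset.mem_filter, Finset.mem_erase]
  exact ⟨fun h => ⟨h.1.2, h.2⟩, fun h => ⟨⟨h.2.ne, h.1⟩, h.2⟩⟩

theorem sg_insert_self (p : ι) (s : Finset ι) : sg p (insert p s) = sg p s := by
  rw [← sg_erase_self p (insert p s), ← sg_erase_self p s, Finset.erase_insert_eq_erase]

theorem sg_insert {p q : ι} {s : Finset ι} (hq : q ∉ s) :
    sg p (insert q s) = (if q < p then -1 else 1) * sg p s := by
  unfold sg
  rw [Finset.filter_insert]
  split_ifs with h
  · rw [Finset.card_insert_of_notMem (by simp [hq]), pow_succ']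
  · rw [one_mul]

theorem sg_union {p : ι} {s t : Finset ι} (h : Disjoint s t) :
    sg p (s ∪ t) = sg p s * sg p t := by
  unfold sg
  rw [Finset.filter_union, Finset.card_union_of_disjoint, pow_add]
  exact Finset.disjoint_filter_filter h

/-- Exchanging two insertions changes the sign. -/
theorem sg_swap {p q : ι} {s : Finset ι} (hp : p ∉ s) (hq : q ∉ s) (hpq : p ≠ q) :
    sg p (insert q s) * sg q s = -(sg q (insert p s) * sg p s) := by
  rw [sg_insert hq, sg_insert hp]
  rcases lt_or_gt_of_ne hpq with h | h
  · simp [h, h.not_gt, mul_comm]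
  · simp [h, h.not_gt, mul_comm]

end Sg

/-- The sign of a list, computed by counting inversions. -/
def listSign {ι : Type*} [LinearOrder ι] : List ι → ℤ
  | [] => 1
  | a :: L => (L.map fun b => if a < b then (1 : ℤ) else -1).prod * listSign L

/-- The inverse of the sorting permutation sends an index to its rank. As `f ∘ sort` is strictly
increasing when `f` has no ties, comparing ranks is comparing values, so the inversions of this
inverse are those of `f`. -/
theorem sign_sort_eq_prod {m : ℕ} {ι : Type*} [LinearOrder ι] (f : Fin m → ι)
    (hf : Function.Injective f) :
    (Equiv.Perm.sign (Tuple.sort f) : ℤ) =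
      ∏ i, ∏ j ∈ Finset.Ioi i, if f i < f j then 1 else -1 := by
  rw [← Equiv.Perm.sign_inv, Equiv.Perm.sign_eq_prod_prod_Ioi]
  push_cast
  refine Finset.prod_congr rfl fun i _ => Finset.prod_congr rfl fun j _ => ?_
  have hm : StrictMono (f ∘ Tuple.sort f) :=
    (Tuple.monotone_sort f).strictMono_of_injective (hf.comp (Equiv.injective _))
  have h := hm.lt_iff_lt (a := (Tuple.sort f)⁻¹ i) (b := (Tuple.sort f)⁻¹ j)
  simp only [Function.comp_apply, Equiv.Perm.inv_def, Equiv.apply_symm_apply] at h ⊢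
  simp only [h]
  split_ifs <;> simp

theorem sign_sort_eq_listSign {m : ℕ} {ι : Type*} [LinearOrder ι] (f : Fin m → ι)
    (hf : Function.Injective f) :
    (Equiv.Perm.sign (Tuple.sort f) : ℤ) = listSign (List.ofFn f) := by
  rw [sign_sort_eq_prod f hf]
  clear hf
  induction m with
  | zero => simp [listSign]
  | succ m ih =>
    rw [Fin.prod_univ_succ, List.ofFn_succ, listSign, ← ih fun i => f i.succ]
    congr 1
    · rw [List.map_ofFn, List.prod_ofFn, Fin.Ioi_zero_eq_map, Finset.prod_map]
      rfl
    · refine Finset.prod_congr rfl fun i _ => ?_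
      rw [Fin.Ioi_succ, Finset.prod_map]
      rfl

theorem sg_eq_sort_prod {ι : Type*} [LinearOrder ι] {a : ι} {s : Finset ι} (ha : a ∉ s) :
    ((s.sort (· ≤ ·)).map fun b => if a < b then (1 : ℤ) else -1).prod = sg a s := by
  have h1 : ((s.sort (· ≤ ·)).map fun b => if a < b then (1 : ℤ) else -1).prod =
      ∏ b ∈ s, if a < b then (1 : ℤ) else -1 := by
    rw [Finset.prod, ← Multiset.prod_coe, ← Multiset.map_coe, Finset.sort_eq]
  rw [h1, sg, Finset.prod_ite, Finset.prod_const_one, one_mul, Finset.prod_const]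
  congr 2
  refine Finset.filter_congr fun b hb => ?_
  have : a ≠ b := fun h => ha (h ▸ hb)
  rw [not_lt]
  exact ⟨fun h => lt_of_le_of_ne h this.symm, le_of_lt⟩

theorem listSign_append {ι : Type*} [LinearOrder ι] (L : List ι) (hL : L.Pairwise (· < ·))
    (t : Finset ι) (ht : ∀ a ∈ L, a ∉ t) :
    listSign (L ++ t.sort (· ≤ ·)) =
      (L.map fun a => sg a t).prod * listSign (t.sort (· ≤ ·)) := by
  induction L with
  | nil => simp
  | cons a L ih =>
    rw [List.pairwise_cons] at hL
    rw [List.cons_append, listSign, ih hL.2 fun b hb => ht b (List.mem_cons_of_mem _ hb),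
      List.map_append, List.prod_append, sg_eq_sort_prod (ht a List.mem_cons_self)]
    have : (L.map fun b => if a < b then (1 : ℤ) else -1).prod = 1 := by
      refine List.prod_eq_one fun x hx => ?_
      obtain ⟨b, hb, rfl⟩ := List.mem_map.1 hx
      rw [if_pos (hL.1 b hb)]
    rw [this, List.map_cons, List.prod_cons]
    ring

theorem listSign_sort {ι : Type*} [LinearOrder ι] (s : Finset ι) :
    listSign (s.sort (· ≤ ·)) = 1 := by
  have h := listSign_append (s.sort (· ≤ ·)) s.sortedLT_sort.pairwise ∅ (by simp)
  have h0 : (∅ : Finset ι).sort (· ≤ ·) = [] := by simp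
  rw [h0, List.append_nil] at h
  rw [h]
  simp [sg_empty, listSign]

theorem listSign_sort_append {ι : Type*} [LinearOrder ι] {s t : Finset ι} (h : Disjoint s t) :
    listSign (s.sort (· ≤ ·) ++ t.sort (· ≤ ·)) = ∏ a ∈ s, sg a t := by
  rw [listSign_append _ s.sortedLT_sort.pairwise t
    fun a ha => Finset.disjoint_left.1 h ((Finset.mem_sort _).1 ha), listSign_sort, mul_one,
    Finset.prod, ← Multiset.prod_coe, ← Multiset.map_coe, Finset.sort_eq]

theorem listSign_cons_sort {ι : Type*} [LinearOrder ι] {p : ι} {t : Finset ι} (h : p ∉ t) :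
    listSign (p :: t.sort (· ≤ ·)) = sg p t := by
  rw [listSign, sg_eq_sort_prod h, listSign_sort, mul_one]

/-- Both blocks are ascending, so only pairs across the two blocks can be inverted. All later sign
identities use this product and no permutations. -/
theorem eps_eq_prod {n : ℕ} {s t : Finset (Fin (n + 1))} (h : Disjoint s t) :
    eps s t = ∏ a ∈ s, sg a t := by
  unfold eps sortSign ascending
  rw [sign_sort_eq_listSign, List.ofFn_get, listSign_sort_append h]
  rw [← List.nodup_iff_injective_get]
  refine List.Nodup.append (s.sort_nodup _) (t.sort_nodup _) ?_
  intro a ha hb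
  exact Finset.disjoint_left.1 h ((Finset.mem_sort _).1 ha) ((Finset.mem_sort _).1 hb)

theorem eps_singleton_left {n : ℕ} {p : Fin (n + 1)} {t : Finset (Fin (n + 1))} (h : p ∉ t) :
    eps {p} t = sg p t := by
  rw [eps_eq_prod (by simpa using h), Finset.prod_singleton]

theorem eps_erase_left {n : ℕ} (p : Fin (n + 1)) (t : Finset (Fin (n + 1))) :
    eps {p} (t.erase p) = sg p t := by
  rw [eps_singleton_left (by simp), sg_erase_self]

theorem eps_mul_self {n : ℕ} {s t : Finset (Fin (n + 1))} (h : Disjoint s t) :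
    eps s t * eps s t = 1 := by
  rw [eps_eq_prod h, ← Finset.prod_mul_distrib]
  exact Finset.prod_eq_one fun a _ => sg_mul_self a t

/-- Each element of `s` contributes exactly one factor $-1$: to the product if it is larger than
`p`, to `sg p s` if it is smaller. -/
theorem prod_sg_singleton_mul_sg {ι : Type*} [LinearOrder ι] {p : ι} {s : Finset ι}
    (h : p ∉ s) : (∏ a ∈ s, sg a {p}) * sg p s = (-1) ^ s.card := by
  induction s using Finset.induction_on with
  | empty => simp [sg_empty]
  | insert a s ha ih =>
    rw [Finset.mem_insert, not_or] at h
    rw [Finset.prod_insert ha, sg_insert ha, Finset.card_insert_of_notMem ha, pow_succ',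
      ← ih h.2]
    have : sg a {p} * (if a < p then -1 else 1) = -1 := by
      rcases lt_or_gt_of_ne h.1 with h' | h'
      · simp [sg, Finset.filter_singleton, h', h'.not_gt]
      · simp [sg, Finset.filter_singleton, h', h'.not_gt]
    linear_combination (∏ x ∈ s, sg x {p}) * sg p s * this

theorem eps_erase_right {n : ℕ} {p : Fin (n + 1)} {t : Finset (Fin (n + 1))} (h : p ∈ t) :
    eps (t.erase p) {p} = (-1) ^ (t.card - 1) * sg p t := by
  rw [eps_eq_prod (by simp), ← sg_erase_self, ← Finset.card_erase_of_mem h,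
    ← prod_sg_singleton_mul_sg (Finset.notMem_erase p t), mul_assoc, sg_mul_self, mul_one]

/-- The sign of `dλ_{θ-p} ∧ dλ_{θᶜ}` relative to `dλ_{[n]-p}`. -/
theorem eps_erase_compl_mul {n : ℕ} {p : Fin (n + 1)} {θ : Finset (Fin (n + 1))} (h : p ∈ θ) :
    eps (θ.erase p) θᶜ * sg p Finset.univ = sg p θ * eps θ θᶜ := by
  rw [eps_eq_prod disjoint_compl_right,
    eps_eq_prod (disjoint_compl_right.mono_left (Finset.erase_subset _ _)),
    ← Finset.mul_prod_erase _ _ h, ← Finset.union_compl θ, sg_union disjoint_compl_right]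
  ring

/-- The sign of the component `dλ_{θᶜ}` in the Whitney form of `(θ-p)ᶜ`. -/
theorem eps_compl_erase_mul {n : ℕ} {p : Fin (n + 1)} {θ : Finset (Fin (n + 1))} (h : p ∈ θ) :
    eps (θ.erase p) (θ.erase p)ᶜ * sg p θᶜ = (-1) ^ (θ.card - 1) * sg p θ * eps θ θᶜ := by
  have hc : (θ.erase p)ᶜ = θᶜ ∪ {p} := by
    rw [Finset.compl_erase, Finset.insert_eq, Finset.union_comm]
  have hd : Disjoint θᶜ {p} := by simpa using h
  rw [eps_eq_prod disjoint_compl_right, eps_eq_prod disjoint_compl_right,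
    ← Finset.mul_prod_erase θ _ h, hc, Finset.prod_congr rfl fun a _ => sg_union hd,
    Finset.prod_mul_distrib, ← Finset.card_erase_of_mem h,
    ← prod_sg_singleton_mul_sg (Finset.notMem_erase p θ), ← sg_erase_self p θ]
  linear_combination (-(sg p θᶜ * (∏ a ∈ θ.erase p, sg a θᶜ) * ∏ a ∈ θ.erase p, sg a {p})) *
    sg_mul_self p (θ.erase p)

/-! ### Koszul operators on families indexed by finite sets -/

section Koszul

variable {ι : Type*} [LinearOrder ι] {M : Type*} [AddCommGroup M]

/-- The exterior multiplication `∑ p, A p • e_p ∧ ·` on families indexed by finite sets. -/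
def kos (A : ι → M →+ M) (c : Finset ι → M) (θ : Finset ι) : M :=
  ∑ p ∈ θ, sg p θ • A p (c (θ.erase p))

/-- The contraction `∑ p, B p • ι_p` on families indexed by finite sets. -/
def con [Fintype ι] (B : ι → M →+ M) (c : Finset ι → M) (τ : Finset ι) : M :=
  ∑ p ∈ τᶜ, sg p τ • B p (c (insert p τ))

theorem kos_add (A : ι → M →+ M) (b c : Finset ι → M) : kos A (b + c) = kos A b + kos A c := by
  ext θ
  simp [kos, Finset.sum_add_distrib]

theorem kos_neg (A : ι → M →+ M) (c : Finset ι → M) : kos A (-c) = -kos A c := by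
  ext θ
  simp [kos]

theorem kos_sub (A : ι → M →+ M) (b c : Finset ι → M) : kos A (b - c) = kos A b - kos A c := by
  rw [sub_eq_add_neg, sub_eq_add_neg, kos_add, kos_neg]

theorem kos_congr (A : ι → M →+ M) {b c : Finset ι → M} {k : ℕ}
    (h : ∀ s : Finset ι, s.card = k → b s = c s) {θ : Finset ι} (hθ : θ.card = k + 1) :
    kos A b θ = kos A c θ := by
  refine Finset.sum_congr rfl fun p hp => ?_
  rw [h _ (by rw [Finset.card_erase_of_mem hp, hθ]; rfl)]

/-- This is the anticommutation of exterior multiplication by one index with contraction by a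
different one. It cancels the mixed terms in the homotopy formula and produces the minus sign in
`MinCondition`. -/
theorem sg_cross {p q : ι} {τ : Finset ι} (hp : p ∉ τ) (hq : q ∈ τ) :
    sg p τ * sg q (insert p τ) = -(sg q τ * sg p (τ.erase q)) := by
  obtain ⟨s, hs, rfl⟩ : ∃ s : Finset ι, q ∉ s ∧ τ = insert q s :=
    ⟨τ.erase q, Finset.notMem_erase _ _, (Finset.insert_erase hq).symm⟩
  rw [Finset.mem_insert, not_or] at hp
  rw [Finset.erase_insert hs, Finset.insert_comm, sg_insert_self, sg_insert_self]
  have h := sg_swap hp.2 hs hp.1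
  have h1 := sg_mul_self q s
  have h2 := sg_mul_self q (insert p s)
  linear_combination (sg q s * sg q (insert p s)) * h - (sg p (insert q s) * sg q (insert p s)) * h1
    - (sg q s * sg p s) * h2

/-- The homotopy formula: mixed terms $p\ne q$ cancel by `sg_cross` and only the diagonal survives.
Commutation is required only for $p\ne q$, so that $A_p=X_p$, $B_p=\partial_p$ is allowed. The other
application takes $A_p=1$ and lets $B$ pick out a single index. -/
theorem kos_con_add_con_kos [Fintype ι] (A B : ι → M →+ M)
    (hAB : ∀ p q, p ≠ q → ∀ x, A p (B q x) = B q (A p x)) (c : Finset ι → M) (τ : Finset ι) :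
    kos A (con B c) τ + con B (kos A c) τ =
      ∑ p ∈ τ, A p (B p (c τ)) + ∑ p ∈ τᶜ, B p (A p (c τ)) := by
  have h1 : kos A (con B c) τ = ∑ q ∈ τ, A q (B q (c τ)) +
      ∑ q ∈ τ, ∑ p ∈ τᶜ, (sg q τ * sg p (τ.erase q)) •
        A q (B p (c (insert p (τ.erase q)))) := by
    rw [← Finset.sum_add_distrib]
    refine Finset.sum_congr rfl fun q hq => ?_
    rw [con, Finset.compl_erase, Finset.sum_insert (by simpa using hq), map_add, smul_add,
      map_zsmul, smul_smul, sg_erase_self, sg_mul_self, one_smul, Finset.insert_erase hq, map_sum,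
      Finset.smul_sum]
    congr 1
    refine Finset.sum_congr rfl fun p _ => ?_
    rw [map_zsmul, smul_smul]
  have h2 : con B (kos A c) τ = ∑ p ∈ τᶜ, B p (A p (c τ)) +
      ∑ p ∈ τᶜ, ∑ q ∈ τ, (sg p τ * sg q (insert p τ)) •
        B p (A q (c ((insert p τ).erase q))) := by
    rw [← Finset.sum_add_distrib]
    refine Finset.sum_congr rfl fun p hp => ?_
    rw [Finset.mem_compl] at hp
    rw [kos, Finset.sum_insert hp, map_add, smul_add, map_zsmul, smul_smul, sg_insert_self,
      sg_mul_self, one_smul, Finset.erase_insert hp, map_sum, Finset.smul_sum]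
    congr 1
    refine Finset.sum_congr rfl fun q _ => ?_
    rw [map_zsmul, smul_smul]
  rw [h1, h2, Finset.sum_comm (s := τᶜ) (t := τ)]
  have h3 : ∑ q ∈ τ, ∑ p ∈ τᶜ, (sg q τ * sg p (τ.erase q)) •
        A q (B p (c (insert p (τ.erase q)))) +
      ∑ q ∈ τ, ∑ p ∈ τᶜ, (sg p τ * sg q (insert p τ)) •
        B p (A q (c ((insert p τ).erase q))) = 0 := by
    rw [← Finset.sum_add_distrib]
    refine Finset.sum_eq_zero fun q hq => ?_
    rw [← Finset.sum_add_distrib]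
    refine Finset.sum_eq_zero fun p hp => ?_
    rw [Finset.mem_compl] at hp
    have hne : q ≠ p := fun h => hp (h ▸ hq)
    rw [sg_cross hp hq, hAB q p hne, Finset.erase_insert_of_ne hne.symm, neg_smul,
      add_neg_cancel]
  rw [add_add_add_comm, h3, add_zero]

/-- Removing $p$ then $q$ and removing $q$ then $p$ give opposite terms; the involution exchanges
the two orders. -/
theorem kos_kos (A : ι → M →+ M) (hA : ∀ p q x, A p (A q x) = A q (A p x))
    (c : Finset ι → M) : kos A (kos A c) = 0 := by
  ext ψ
  simp only [kos, map_sum, map_zsmul, Finset.smul_sum, smul_smul, Pi.zero_apply]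
  rw [Finset.sum_sigma']
  refine Finset.sum_involution (fun x _ => ⟨x.2, x.1⟩) ?_ ?_ ?_ ?_
  · rintro ⟨p, q⟩ h
    simp only [Finset.mem_sigma, Finset.mem_erase] at h
    obtain ⟨hp, hqp, hq⟩ := h
    obtain ⟨s, hps, hqs, rfl⟩ : ∃ s : Finset ι, p ∉ s ∧ q ∉ s ∧ ψ = insert p (insert q s) :=
      ⟨(ψ.erase p).erase q, by simp, by simp, by
        rw [Finset.insert_erase (by simp [hqp, hq]), Finset.insert_erase hp]⟩
    have e1 : (insert p (insert q s)).erase p = insert q s :=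
      Finset.erase_insert (by simp [hqp.symm, hps])
    have e2 : (insert p (insert q s)).erase q = insert p s := by
      rw [Finset.insert_comm, Finset.erase_insert (by simp [hqp, hqs])]
    simp only [e1, e2, Finset.erase_insert hps, Finset.erase_insert hqs, sg_insert_self]
    rw [Finset.insert_comm p q, sg_insert_self, hA p q, ← add_smul,
      sg_swap hps hqs hqp.symm, neg_add_cancel, zero_smul]
  · rintro ⟨p, q⟩ h _ h'
    simp only [Finset.mem_sigma, Finset.mem_erase] at h
    exact h.2.1 (congrArg Sigma.fst h')
  · rintro ⟨p, q⟩ h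
    simp only [Finset.mem_sigma, Finset.mem_erase] at h ⊢
    exact ⟨h.2.2, h.2.1.symm, h.1⟩
  · rintro ⟨p, q⟩ _
    rfl

theorem sum_erase_eq_sum_insert [Fintype ι] {N : Type*} [AddCommMonoid N]
    (g : ι → Finset ι → Finset ι → N) :
    ∑ s : Finset ι, ∑ p ∈ s, g p (s.erase p) s = ∑ s : Finset ι, ∑ p ∈ sᶜ, g p s (insert p s) := by
  rw [Finset.sum_sigma', Finset.sum_sigma']
  refine Finset.sum_bij' (fun x _ => ⟨x.1.erase x.2, x.2⟩) (fun x _ => ⟨insert x.2 x.1, x.2⟩)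
    ?_ ?_ ?_ ?_ ?_
  · rintro ⟨s, p⟩ _
    simp
  · rintro ⟨s, p⟩ _
    simp
  · rintro ⟨s, p⟩ h
    simp only [Finset.mem_sigma, Finset.mem_univ, true_and] at h
    simp [Finset.insert_erase h]
  · rintro ⟨s, p⟩ h
    simp only [Finset.mem_sigma, Finset.mem_univ, true_and, Finset.mem_compl] at h
    simp [Finset.erase_insert h]
  · rintro ⟨s, p⟩ h
    simp only [Finset.mem_sigma, Finset.mem_univ, true_and] at h
    simp [Finset.insert_erase h]

end Koszul

/-! ### Determinant forms and the exterior product -/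

section DetForm

open scoped TensorProduct

variable {M : Type*} [AddCommGroup M] [Module ℝ M]

/-- Evaluation of alternating forms as a complex linear map. -/
noncomputable def evalForm {k : ℕ} (v : Fin k → M) : (M [⋀^Fin k]→ₗ[ℝ] ℂ) →ₗ[ℂ] ℂ where
  toFun a := a v
  map_add' _ _ := rfl
  map_smul' _ _ := rfl

theorem altMap_sum_apply {κ : Type*} {k : ℕ} (s : Finset κ) (f : κ → M [⋀^Fin k]→ₗ[ℝ] ℂ)
    (v : Fin k → M) : (∑ i ∈ s, f i) v = ∑ i ∈ s, f i v :=
  map_sum (evalForm v) f s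

/-- The exterior product of a family of covectors. -/
noncomputable def detForm {ι : Type*} [Fintype ι] [DecidableEq ι] (f : ι → M →ₗ[ℝ] ℂ) : M [⋀^ι]→ₗ[ℝ] ℂ :=
  MultilinearMap.alternatization ((MultilinearMap.mkPiAlgebra ℝ ι ℂ).compLinearMap f)

theorem detForm_apply {ι : Type*} [Fintype ι] [DecidableEq ι] (f : ι → M →ₗ[ℝ] ℂ) (v : ι → M) :
    detForm f v = (Matrix.of fun i j => f j (v i)).det := by
  rw [detForm, MultilinearMap.alternatization_apply, Matrix.det_apply]
  rfl

theorem detForm_comp_perm {ι : Type*} [Fintype ι] [DecidableEq ι] (f : ι → M →ₗ[ℝ] ℂ)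
    (π : Equiv.Perm ι) : detForm (f ∘ π) = (Equiv.Perm.sign π : ℤ) • detForm f := by
  ext v
  rw [AlternatingMap.smul_apply, detForm_apply, detForm_apply, zsmul_eq_mul]
  exact Matrix.det_permute' π (Matrix.of fun i j => f j (v i))

theorem detForm_eq_zero_of_eq {ι : Type*} [Fintype ι] [DecidableEq ι] (f : ι → M →ₗ[ℝ] ℂ)
    {i j : ι} (hij : i ≠ j) (h : f i = f j) : detForm f = 0 := by
  ext v
  rw [detForm_apply]
  exact Matrix.det_zero_of_column_eq hij fun a => by simp [h]

/-- Expansion along the first column shows linearity in the first covector. It is meant for the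
relation $\sum_p d\lambda_p=0$. -/
theorem sum_detForm_cons {κ : Type*} [Fintype κ] {k : ℕ} (f : κ → M →ₗ[ℝ] ℂ) (hf : ∑ p, f p = 0)
    (g : Fin k → M →ₗ[ℝ] ℂ) :
    ∑ p, detForm (Fin.cons (f p) g : Fin (k + 1) → M →ₗ[ℝ] ℂ) = 0 := by
  ext v
  rw [altMap_sum_apply]
  simp only [detForm_apply, Matrix.det_succ_column_zero]
  rw [Finset.sum_comm]
  refine Finset.sum_eq_zero fun i _ => ?_
  simp only [Matrix.of_apply, Fin.cons_zero, Matrix.submatrix, Fin.cons_succ]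
  rw [← Finset.sum_mul, ← Finset.mul_sum, ← LinearMap.sum_apply, hf]
  simp

/-- A determinant form is the alternatization of a product of covectors, and the shuffle product of
alternatizations is the alternatization of the product. This holds over `Fin k ⊕ Fin l` and is then
moved to `Fin (k + l)`. -/
theorem altWedge_detForm {k l : ℕ} (f : Fin k → M →ₗ[ℝ] ℂ) (g : Fin l → M →ₗ[ℝ] ℂ) :
    altWedge (detForm f) (detForm g) = detForm (Fin.append f g) := by
  have h : (LinearMap.mul' ℝ ℂ).compAlternatingMap ((detForm f).domCoprod (detForm g)) =
      detForm (Sum.elim f g) := by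
    rw [detForm, detForm, ← MultilinearMap.domCoprod_alternization,
      ← LinearMap.compMultilinearMap_alternatization, detForm]
    congr 1
    ext v
    simp [Fintype.prod_sum_type]
  rw [altWedge, h]
  ext v
  rw [AlternatingMap.domDomCongr_apply, detForm_apply, detForm_apply,
    ← Matrix.det_submatrix_equiv_self finSumFinEquiv]
  congr 1
  ext i j
  rcases j with j | j <;> simp

theorem altWedge_add_left {k l : ℕ} (a a' : M [⋀^Fin k]→ₗ[ℝ] ℂ) (b : M [⋀^Fin l]→ₗ[ℝ] ℂ) :
    altWedge (a + a') b = altWedge a b + altWedge a' b := by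
  have h : (a + a').domCoprod b = a.domCoprod b + a'.domCoprod b := by
    simp only [← AlternatingMap.domCoprod'_apply, TensorProduct.add_tmul, map_add]
  ext v
  simp [altWedge, h]

theorem altWedge_add_right {k l : ℕ} (a : M [⋀^Fin k]→ₗ[ℝ] ℂ) (b b' : M [⋀^Fin l]→ₗ[ℝ] ℂ) :
    altWedge a (b + b') = altWedge a b + altWedge a b' := by
  have h : a.domCoprod (b + b') = a.domCoprod b + a.domCoprod b' := by
    simp only [← AlternatingMap.domCoprod'_apply, TensorProduct.tmul_add, map_add]
  ext v
  simp [altWedge, h]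

/-- The tensor product inside `domCoprod` is over ℝ, so complex homogeneity does not come from its
bilinearity. It appears in each shuffle term after multiplication in ℂ. -/
theorem altWedge_smul_left {k l : ℕ} (c : ℂ) (a : M [⋀^Fin k]→ₗ[ℝ] ℂ) (b : M [⋀^Fin l]→ₗ[ℝ] ℂ) :
    altWedge (c • a) b = c • altWedge a b := by
  ext v
  simp only [altWedge, AlternatingMap.domDomCongr_apply, LinearMap.compAlternatingMap_apply,
    AlternatingMap.smul_apply, AlternatingMap.domCoprod_apply, _root_.sum_apply, map_sum,
    Finset.smul_sum]
  refine Finset.sum_congr rfl fun σ _ => ?_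
  induction σ using Quotient.inductionOn' with | _ σ
  change LinearMap.mul' ℝ ℂ (Equiv.Perm.sign σ • ((c • a fun i => v (finSumFinEquiv (σ (Sum.inl i)))) ⊗ₜ[ℝ]
      b fun i => v (finSumFinEquiv (σ (Sum.inr i))))) =
    c • LinearMap.mul' ℝ ℂ (Equiv.Perm.sign σ • ((a fun i => v (finSumFinEquiv (σ (Sum.inl i)))) ⊗ₜ[ℝ]
      b fun i => v (finSumFinEquiv (σ (Sum.inr i)))))
  rcases Int.units_eq_one_or (Equiv.Perm.sign σ) with h | h <;>
    simp [h, mul_assoc]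

theorem altWedge_smul_right {k l : ℕ} (c : ℂ) (a : M [⋀^Fin k]→ₗ[ℝ] ℂ)
    (b : M [⋀^Fin l]→ₗ[ℝ] ℂ) : altWedge a (c • b) = c • altWedge a b := by
  ext v
  simp only [altWedge, AlternatingMap.domDomCongr_apply, LinearMap.compAlternatingMap_apply,
    AlternatingMap.smul_apply, AlternatingMap.domCoprod_apply, _root_.sum_apply, map_sum,
    Finset.smul_sum]
  refine Finset.sum_congr rfl fun σ _ => ?_
  induction σ using Quotient.inductionOn' with | _ σ
  change LinearMap.mul' ℝ ℂ (Equiv.Perm.sign σ • ((a fun i => v (finSumFinEquiv (σ (Sum.inl i)))) ⊗ₜ[ℝ]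
      (c • b fun i => v (finSumFinEquiv (σ (Sum.inr i)))))) =
    c • LinearMap.mul' ℝ ℂ (Equiv.Perm.sign σ • ((a fun i => v (finSumFinEquiv (σ (Sum.inl i)))) ⊗ₜ[ℝ]
      b fun i => v (finSumFinEquiv (σ (Sum.inr i)))))
  rcases Int.units_eq_one_or (Equiv.Perm.sign σ) with h | h <;>
    simp [h, mul_left_comm]

/-- The exterior product as a complex bilinear map. -/
noncomputable def altWedgeBilin (M : Type*) [AddCommGroup M] [Module ℝ M] (k l : ℕ) :
    (M [⋀^Fin k]→ₗ[ℝ] ℂ) →ₗ[ℂ] (M [⋀^Fin l]→ₗ[ℝ] ℂ) →ₗ[ℂ] (M [⋀^Fin (k + l)]→ₗ[ℝ] ℂ) :=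
  LinearMap.mk₂ ℂ altWedge altWedge_add_left altWedge_smul_left altWedge_add_right
    altWedge_smul_right

theorem altWedgeBilin_apply {k l : ℕ} (a : M [⋀^Fin k]→ₗ[ℝ] ℂ) (b : M [⋀^Fin l]→ₗ[ℝ] ℂ) :
    altWedgeBilin M k l a b = altWedge a b := rfl

end DetForm

/-! ### Barycentric alternators -/

section Alternators

variable {V : Type*} [AddCommGroup V] [Module ℝ V] {n : ℕ}

/-- The covector `dλᵢ`. -/
noncomputable def dcov (T : Affine.Simplex ℝ V n) (i : Fin (n + 1)) : Tangent T →ₗ[ℝ] ℂ :=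
  Complex.ofRealCLM.toLinearMap ∘ₗ ((vertexBasis T).coord i).linear

/-- The tangent vector `v_t - v_q`. -/
noncomputable def vec (T : Affine.Simplex ℝ V n) (q t : Fin (n + 1)) : Tangent T :=
  ⟨T.points t - T.points q,
    AffineSubspace.vsub_mem_direction (mem_affineSpan ℝ (Set.mem_range_self _))
      (mem_affineSpan ℝ (Set.mem_range_self _))⟩

theorem coord_linear_vec (T : Affine.Simplex ℝ V n) (i q t : Fin (n + 1)) :
    ((vertexBasis T).coord i).linear (vec T q t) =
      (if i = t then 1 else 0) - (if i = q then 1 else 0) := by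
  have h : vec T q t = (vertexBasis T t) -ᵥ (vertexBasis T q) := rfl
  rw [h, AffineMap.linearMap_vsub, AffineBasis.coord_apply, AffineBasis.coord_apply]
  rfl

theorem dcov_vec (T : Affine.Simplex ℝ V n) (i q t : Fin (n + 1)) :
    dcov T i (vec T q t) = (if i = t then 1 else 0) - (if i = q then 1 else 0) := by
  have h : dcov T i (vec T q t) = (((vertexBasis T).coord i).linear (vec T q t) : ℂ) := rfl
  rw [h, coord_linear_vec]
  split_ifs <;> simp

/-- This is the differential of $\sum_i\lambda_i=1$, computed as a difference of coordinates at two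
points. -/
theorem sum_dcov (T : Affine.Simplex ℝ V n) : ∑ i, dcov T i = 0 := by
  ext v
  obtain ⟨p⟩ : Nonempty (Hull T) := ⟨vertexBasis T 0⟩
  have h : ∀ i, dcov T i v =
      (((vertexBasis T).coord i (v +ᵥ p) - (vertexBasis T).coord i p : ℝ) : ℂ) := by
    intro i
    rw [AffineMap.map_vadd, vadd_eq_add, add_sub_cancel_right]
    rfl
  rw [LinearMap.sum_apply, Finset.sum_congr rfl fun i _ => h i, ← Complex.ofReal_sum,
    Finset.sum_sub_distrib, AffineBasis.sum_coord_apply_eq_one,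
    AffineBasis.sum_coord_apply_eq_one]
  simp

/-- The alternating form `dλ_s` for a set of `k` indices, and zero for any other set. -/
noncomputable def dl (T : Affine.Simplex ℝ V n) (k : ℕ) (s : Finset (Fin (n + 1))) :
    (Tangent T) [⋀^Fin k]→ₗ[ℝ] ℂ :=
  if h : s.card = k then detForm fun i => dcov T (s.orderEmbOfFin h i) else 0

theorem dl_of_card (T : Affine.Simplex ℝ V n) {k : ℕ} {s : Finset (Fin (n + 1))}
    (h : s.card = k) : dl T k s = detForm fun i => dcov T (s.orderEmbOfFin h i) := dif_pos h

theorem dl_of_card_ne (T : Affine.Simplex ℝ V n) {k : ℕ} {s : Finset (Fin (n + 1))}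
    (h : s.card ≠ k) : dl T k s = 0 := dif_neg h

theorem dlamSeq_eq_detForm (T : Affine.Simplex ℝ V n) (k : ℕ) (s : Fin k → Fin (n + 1))
    (x : Carrier T) : dlamSeq T k s x = detForm fun i => dcov T (s i) := by
  induction k with
  | zero =>
    ext v
    rw [detForm_apply, Matrix.det_isEmpty]
    rfl
  | succ k ih =>
    have h1 : dlam T (s (Fin.last k)) x = detForm fun _ : Fin 1 => dcov T (s (Fin.last k)) := by
      ext v
      rw [detForm_apply, Matrix.det_unique]
      rfl
    change altWedge (dlamSeq T k (fun i => s i.castSucc) x) (dlam T (s (Fin.last k)) x) = _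
    rw [ih, h1, altWedge_detForm]
    congr 1
    ext i : 1
    refine Fin.lastCases ?_ (fun j => ?_) i
    · exact Fin.append_right _ _ (0 : Fin 1)
    · exact Fin.append_left _ _ j

theorem dlamAlt_eq_dl (T : Affine.Simplex ℝ V n) {k : ℕ} (σ : AltIdx k n) (x : Carrier T) :
    dlamAlt T σ x = dl T k σ.1 := by
  rw [dlamAlt, dlamSeq_eq_detForm, dl_of_card T σ.2]

theorem detForm_dcov_of_injective (T : Affine.Simplex ℝ V n) {k : ℕ} (s : Fin k → Fin (n + 1))
    (hs : Function.Injective s) :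
    detForm (fun i => dcov T (s i)) =
      listSign (List.ofFn s) • dl T k (Finset.univ.image s) := by
  have hc : (Finset.univ.image s).card = k := by
    rw [Finset.card_image_of_injective _ hs, Finset.card_univ, Fintype.card_fin]
  have hm : StrictMono (s ∘ Tuple.sort s) :=
    (Tuple.monotone_sort s).strictMono_of_injective (hs.comp (Equiv.injective _))
  have he := Finset.orderEmbOfFin_unique hc (f := s ∘ Tuple.sort s) (by simp) hm
  have h2 := detForm_comp_perm (fun i => dcov T (s i)) (Tuple.sort s)
  have h3 : dl T k (Finset.univ.image s) =
      detForm ((fun i => dcov T (s i)) ∘ Tuple.sort s) := by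
    rw [dl_of_card T hc, ← he]
    rfl
  rw [h3, h2, ← sign_sort_eq_listSign s hs, smul_smul, ← Units.val_mul, Int.units_mul_self,
    Units.val_one, one_smul]

theorem ofFn_orderEmbOfFin {k : ℕ} {s : Finset (Fin (n + 1))} (h : s.card = k) :
    List.ofFn (s.orderEmbOfFin h) = s.sort (· ≤ ·) := by
  rw [List.ofFn_eq_map, Finset.listMap_orderEmbOfFin_finRange]

theorem detForm_cons_dcov (T : Affine.Simplex ℝ V n) {k : ℕ} {s : Finset (Fin (n + 1))}
    (h : s.card = k) (p : Fin (n + 1)) :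
    detForm (Fin.cons (dcov T p) fun i => dcov T (s.orderEmbOfFin h i) :
        Fin (k + 1) → Tangent T →ₗ[ℝ] ℂ) =
      if p ∈ s then 0 else sg p s • dl T (k + 1) (insert p s) := by
  split_ifs with hp
  · obtain ⟨i, rfl⟩ : p ∈ Set.range (s.orderEmbOfFin h) := by simpa using hp
    exact detForm_eq_zero_of_eq _ (i := 0) (j := i.succ) (Fin.succ_ne_zero i).symm (by simp)
  · have hi : Function.Injective (Fin.cons p (s.orderEmbOfFin h) : Fin (k + 1) → Fin (n + 1)) := by
      rw [Fin.cons_injective_iff]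
      refine ⟨?_, (s.orderEmbOfFin h).injective⟩
      simpa using hp
    have hd := detForm_dcov_of_injective T _ hi
    have e1 : Finset.univ.image (Fin.cons p (s.orderEmbOfFin h) : Fin (k + 1) → Fin (n + 1)) =
        insert p s := by
      ext x
      have : x ∈ s ↔ ∃ i, s.orderEmbOfFin h i = x := by
        rw [← Finset.mem_coe, ← s.range_orderEmbOfFin h]
        rfl
      simp [Fin.exists_fin_succ, this, eq_comm]
    rw [e1, List.ofFn_succ] at hd
    simp only [Fin.cons_zero, Fin.cons_succ] at hd
    rw [ofFn_orderEmbOfFin, listSign_cons_sort hp] at hd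
    rw [← hd]
    congr 1
    ext i : 1
    refine Fin.cases ?_ (fun j => ?_) i <;> simp

theorem altWedge_dl (T : Affine.Simplex ℝ V n) {k l : ℕ} {s t : Finset (Fin (n + 1))}
    (hs : s.card = k) (ht : t.card = l) :
    altWedge (dl T k s) (dl T l t) =
      if Disjoint s t then eps s t • dl T (k + l) (s ∪ t) else 0 := by
  rw [dl_of_card T hs, dl_of_card T ht, altWedge_detForm]
  have hcomp : Fin.append (fun i => dcov T (s.orderEmbOfFin hs i))
      (fun i => dcov T (t.orderEmbOfFin ht i)) =
      fun i => dcov T (Fin.append (s.orderEmbOfFin hs) (t.orderEmbOfFin ht) i) := by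
    ext i : 1
    refine Fin.addCases (fun j => ?_) (fun j => ?_) i <;> simp
  have hms : ∀ x, x ∈ s ↔ ∃ i, s.orderEmbOfFin hs i = x := fun x => by
    rw [← Finset.mem_coe, ← s.range_orderEmbOfFin hs]; rfl
  have hmt : ∀ x, x ∈ t ↔ ∃ i, t.orderEmbOfFin ht i = x := fun x => by
    rw [← Finset.mem_coe, ← t.range_orderEmbOfFin ht]; rfl
  rw [hcomp]
  split_ifs with hd
  · have hi : Function.Injective (Fin.append (s.orderEmbOfFin hs) (t.orderEmbOfFin ht)) := by
      rw [Fin.append_injective_iff]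
      refine ⟨(s.orderEmbOfFin hs).injective, (t.orderEmbOfFin ht).injective, fun i j h => ?_⟩
      exact Finset.disjoint_left.1 hd (s.orderEmbOfFin_mem hs i) (h ▸ t.orderEmbOfFin_mem ht j)
    rw [detForm_dcov_of_injective T _ hi, List.ofFn_fin_append, ofFn_orderEmbOfFin,
      ofFn_orderEmbOfFin, listSign_sort_append hd, eps_eq_prod hd]
    congr 2
    ext x
    rw [Finset.mem_union, hms, hmt, Finset.mem_image]
    constructor
    · rintro ⟨i, -, rfl⟩
      refine Fin.addCases (fun j => ?_) (fun j => ?_) i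
      · exact Or.inl ⟨j, by simp⟩
      · exact Or.inr ⟨j, by simp⟩
    · rintro (⟨j, rfl⟩ | ⟨j, rfl⟩)
      · exact ⟨Fin.castAdd l j, Finset.mem_univ _, by simp⟩
      · exact ⟨Fin.natAdd k j, Finset.mem_univ _, by simp⟩
  · obtain ⟨x, hx, hx'⟩ := Finset.not_disjoint_iff.1 hd
    obtain ⟨i, rfl⟩ := (hms x).1 hx
    obtain ⟨j, hj⟩ := (hmt _).1 hx'
    refine detForm_eq_zero_of_eq _ (i := Fin.castAdd l i) (j := Fin.natAdd k j) ?_ ?_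
    · intro h
      have := congrArg Fin.val h
      simp at this
      omega
    · simp [hj]

/-- Away from $q$, $d\lambda_i(v_t-v_q)=\delta_{it}$. The determinant is that of the identity when
$s=\tau$; otherwise an index of $s\setminus\tau$ gives a zero column. Thus the $d\lambda_s$ with
$q\notin s$ are dual to the edges issuing from $v_q$. -/
theorem dl_vec (T : Affine.Simplex ℝ V n) {k : ℕ} {s τ : Finset (Fin (n + 1))} {q : Fin (n + 1)}
    (hτ : τ.card = k) (hs : q ∉ s) :
    dl T k s (fun i => vec T q (τ.orderEmbOfFin hτ i)) = if s = τ then 1 else 0 := by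
  by_cases hc : s.card = k
  swap
  · rw [dl_of_card_ne T hc, if_neg fun h : s = τ => hc (h ▸ hτ)]
    rfl
  have hne : ∀ j, s.orderEmbOfFin hc j ≠ q := fun j h => hs (h ▸ s.orderEmbOfFin_mem hc j)
  rw [dl_of_card T hc, detForm_apply]
  simp only [dcov_vec, hne, if_false, sub_zero]
  split_ifs with h
  · subst h
    rw [← Matrix.det_one (n := Fin k)]
    congr 1
    ext i j
    simp [Matrix.one_apply, eq_comm]
  · obtain ⟨x, hx, hx'⟩ : ∃ x ∈ s, x ∉ τ := by
      by_contra! h'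
      exact h (Finset.eq_of_subset_of_card_le h' (by rw [hc, hτ]))
    obtain ⟨j, rfl⟩ : x ∈ Set.range (s.orderEmbOfFin hc) := by simpa using hx
    refine Matrix.det_eq_zero_of_column_eq_zero j fun i => ?_
    rw [Matrix.of_apply, if_neg]
    intro h'
    exact hx' (h' ▸ τ.orderEmbOfFin_mem hτ i)

/-- The alternating form `∑ c_s dλ_s`. -/
noncomputable def altSum (T : Affine.Simplex ℝ V n) (k : ℕ) (c : Finset (Fin (n + 1)) → ℂ) :
    (Tangent T) [⋀^Fin k]→ₗ[ℝ] ℂ :=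
  ∑ s, c s • dl T k s

/-- Multiplication by one in all directions. -/
abbrev unitOp (ι M : Type*) [AddCommGroup M] : ι → M →+ M := fun _ => AddMonoidHom.id M

/-- Grouped by the smaller set, the sum consists of multiples of $(\sum_p d\lambda_p)\wedge
d\lambda_s=0$. -/
theorem altSum_kos (T : Affine.Simplex ℝ V n) (k : ℕ) (b : Finset (Fin (n + 1)) → ℂ) :
    altSum T k (kos (unitOp _ ℂ) b) = 0 := by
  have h1 : altSum T k (kos (unitOp _ ℂ) b) =
      ∑ s : Finset (Fin (n + 1)), ∑ p ∈ s, b (s.erase p) • sg p (s.erase p) • dl T k s := by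
    refine Finset.sum_congr rfl fun s _ => ?_
    rw [kos, Finset.sum_smul]
    refine Finset.sum_congr rfl fun p _ => ?_
    rw [sg_erase_self, AddMonoidHom.id_apply, smul_assoc, smul_comm]
  rw [h1, sum_erase_eq_sum_insert fun p s s' => b s • sg p s • dl T k s']
  refine Finset.sum_eq_zero fun s _ => ?_
  rw [← Finset.smul_sum]
  by_cases hc : s.card + 1 = k
  · subst hc
    have := sum_detForm_cons (dcov T) (sum_dcov T) (fun i => dcov T (s.orderEmbOfFin rfl i))
    simp only [detForm_cons_dcov T rfl] at this
    rw [Finset.sum_ite, Finset.sum_const_zero, zero_add] at this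
    have e : Finset.univ.filter (fun p => p ∉ s) = sᶜ := by ext; simp
    rw [e] at this
    rw [this, smul_zero]
  · rw [Finset.sum_eq_zero, smul_zero]
    intro p hp
    rw [dl_of_card_ne, smul_zero]
    rwa [Finset.card_insert_of_notMem (Finset.mem_compl.1 hp)]

theorem altSum_add (T : Affine.Simplex ℝ V n) (k : ℕ) (b c : Finset (Fin (n + 1)) → ℂ) :
    altSum T k (b + c) = altSum T k b + altSum T k c := by
  simp [altSum, add_smul, Finset.sum_add_distrib]

/-- Elimination of `dλ_q` from a form. -/
theorem altSum_eq_altSum_con_kos (T : Affine.Simplex ℝ V n) (k : ℕ)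
    (c : Finset (Fin (n + 1)) → ℂ) (q : Fin (n + 1)) :
    altSum T k c = ∑ s, (if q ∈ s then 0 else sg q s • kos (unitOp _ ℂ) c (insert q s)) •
      dl T k s := by
  -- Contraction along $q$ alone: the diagonal of the homotopy formula is then $c$ itself, so
  -- $c=\mathrm{kos}(\mathrm{con}\,c)+\mathrm{con}(\mathrm{kos}\,c)$, and `altSum_kos` removes the
  -- first summand.
  set B : Fin (n + 1) → ℂ →+ ℂ := fun p => if p = q then AddMonoidHom.id ℂ else 0 with hB
  have hcon : con B (kos (unitOp _ ℂ) c) =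
      fun s => if q ∈ s then 0 else sg q s • kos (unitOp _ ℂ) c (insert q s) := by
    ext s
    have : ∀ p ∈ sᶜ, sg p s • B p (kos (unitOp _ ℂ) c (insert p s)) =
        if q = p then sg q s • kos (unitOp _ ℂ) c (insert q s) else 0 := by
      intro p _
      rw [hB]
      split_ifs with h
      · subst h; simp
      · simp [Ne.symm h]
    rw [con, Finset.sum_congr rfl this, Finset.sum_ite_eq]
    by_cases h : q ∈ s <;> simp [h]
  have hc : c = kos (unitOp _ ℂ) (con B c) + con B (kos (unitOp _ ℂ) c) := by
    ext τ
    rw [Pi.add_apply, kos_con_add_con_kos (unitOp _ ℂ) B (fun _ _ _ _ => rfl)]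
    simp only [AddMonoidHom.id_apply]
    rw [Finset.sum_add_sum_compl, Finset.sum_eq_single q]
    · simp [hB]
    · intro p _ hp
      simp [hB, hp]
    · simp
  conv_lhs => rw [hc, altSum_add, altSum_kos, zero_add, hcon]
  rfl

/-- After elimination of one $d\lambda_q$ the remaining coefficients are entries of `kos`. The
choice $q=0$ is arbitrary. -/
theorem altSum_eq_zero (T : Affine.Simplex ℝ V n) {k : ℕ} {c : Finset (Fin (n + 1)) → ℂ}
    (h : ∀ θ : Finset (Fin (n + 1)), θ.card = k + 1 → kos (unitOp _ ℂ) c θ = 0) :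
    altSum T k c = 0 := by
  rw [altSum_eq_altSum_con_kos T k c 0]
  refine Finset.sum_eq_zero fun s _ => ?_
  by_cases hs : s.card = k
  · by_cases hq : (0 : Fin (n + 1)) ∈ s
    · simp [hq]
    · rw [if_neg hq, h _ (by rw [Finset.card_insert_of_notMem hq, hs]), smul_zero, zero_smul]
  · rw [dl_of_card_ne T hs, smul_zero]

/-- Conversely the entries of `kos` are determined by the form: up to sign they are its values on
the edges from $v_q$ in the subsimplex spanned by $\tau+q$. -/
theorem altSum_vec (T : Affine.Simplex ℝ V n) {k : ℕ} (c : Finset (Fin (n + 1)) → ℂ)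
    {τ : Finset (Fin (n + 1))} {q : Fin (n + 1)} (hτ : τ.card = k) (hq : q ∉ τ) :
    altSum T k c (fun i => vec T q (τ.orderEmbOfFin hτ i)) =
      sg q τ • kos (unitOp _ ℂ) c (insert q τ) := by
  rw [altSum_eq_altSum_con_kos T k c q, altMap_sum_apply, Finset.sum_eq_single τ]
  · rw [if_neg hq, AlternatingMap.smul_apply, dl_vec T hτ hq, if_pos rfl, smul_eq_mul, mul_one]
  · intro s _ hs
    by_cases h : q ∈ s
    · simp [h]
    · rw [AlternatingMap.smul_apply, dl_vec T hτ h, if_neg hs, smul_zero]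
  · simp

theorem edge_eq_vec (T : Affine.Simplex ℝ V n) :
    edge T = fun i => vec T 0 ((Finset.univ.erase 0).orderEmbOfFin
      (by simp : (Finset.univ.erase (0 : Fin (n + 1))).card = n) i) := by
  have h : Fin.succ = (Finset.univ.erase 0).orderEmbOfFin
      (by simp : (Finset.univ.erase (0 : Fin (n + 1))).card = n) :=
    Finset.orderEmbOfFin_unique _ (by simp [Fin.succ_ne_zero]) (Fin.strictMono_succ)
  rw [← h]
  rfl

theorem dl_edge (T : Affine.Simplex ℝ V n) (p : Fin (n + 1)) :
    dl T n (Finset.univ.erase p) (edge T) = sg p Finset.univ := by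
  have h1 : dl T n (Finset.univ.erase p) =
      altSum T n (Pi.single (Finset.univ.erase p) 1) := by
    rw [altSum, Finset.sum_eq_single (Finset.univ.erase p)]
    · simp
    · intro s _ hs
      simp [hs]
    · simp
  have h0 : sg (0 : Fin (n + 1)) (Finset.univ.erase 0) = 1 := by simp [sg]
  rw [h1, edge_eq_vec, altSum_vec T _ _ (by simp), h0, one_smul,
    Finset.insert_erase (Finset.mem_univ _), kos, Finset.sum_eq_single p]
  · simp
  · intro q _ hq
    rw [AddMonoidHom.id_apply, Pi.single_eq_of_ne, smul_zero]
    intro h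
    have : q ∈ Finset.univ.erase q := by rw [h]; simp [hq]
    simp at this
  · simp

end Alternators

/-! ### Forms with polynomial coefficients -/

section PolyForm

open MvPolynomial

variable {V : Type*} [AddCommGroup V] [Module ℝ V] {n : ℕ}

/-- The barycentric coordinates of a point as complex numbers. -/
noncomputable def pt (T : Affine.Simplex ℝ V n) (x : Carrier T) : Fin (n + 1) → ℂ :=
  fun i => (lam T i x : ℂ)

/-- The form `∑ c_s dλ_s` with polynomial coefficients in barycentric coordinates. -/
noncomputable def polyForm (T : Affine.Simplex ℝ V n) (k : ℕ)
    (c : Finset (Fin (n + 1)) → MvPolynomial (Fin (n + 1)) ℂ) : Form T k :=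
  fun x => altSum T k fun s => eval (pt T x) (c s)

/-- Multiplication by the variables. -/
noncomputable abbrev mulX (n : ℕ) :
    Fin (n + 1) → MvPolynomial (Fin (n + 1)) ℂ →+ MvPolynomial (Fin (n + 1)) ℂ :=
  fun p => AddMonoidHom.mulLeft (X p)

/-- A multiindex as an exponent. -/
noncomputable def MultiIdx.exponent {r n : ℕ} (α : MultiIdx r n) : Fin (n + 1) →₀ ℕ :=
  Finsupp.equivFunOnFinite.symm α.1

/-- The polynomials `∑ ω_{ασ} X^α`. -/
noncomputable def coefPoly {r k n : ℕ} (ω : MultiIdx r n → AltIdx k n → ℂ)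
    (s : Finset (Fin (n + 1))) : MvPolynomial (Fin (n + 1)) ℂ :=
  if h : s.card = k then ∑ α : MultiIdx r n, monomial α.exponent (ω α ⟨s, h⟩) else 0

theorem coefPoly_of_card_ne {r k n : ℕ} (ω : MultiIdx r n → AltIdx k n → ℂ)
    {s : Finset (Fin (n + 1))} (h : s.card ≠ k) : coefPoly ω s = 0 := dif_neg h

/-- The coefficients of `∑ a_s λ_{sᶜ} dλ_s`. -/
noncomputable def bubbleCoef (a : Finset (Fin (n + 1)) → MvPolynomial (Fin (n + 1)) ℂ)
    (s : Finset (Fin (n + 1))) : MvPolynomial (Fin (n + 1)) ℂ :=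
  (∏ i ∈ sᶜ, X i) * a s

/-- The coefficients of `∑ ε(s,sᶜ) a_s φ_{sᶜ}`. -/
noncomputable def whitneyCoef (k : ℕ) (a : Finset (Fin (n + 1)) → MvPolynomial (Fin (n + 1)) ℂ)
    (t : Finset (Fin (n + 1))) : MvPolynomial (Fin (n + 1)) ℂ :=
  ((-1) ^ k * eps tᶜ t : ℤ) • kos (mulX n) a tᶜ

theorem eval_monomial_exponent (T : Affine.Simplex ℝ V n) {r : ℕ} (α : MultiIdx r n) (z : ℂ)
    (x : Carrier T) : eval (pt T x) (monomial α.exponent z) = z * (lamPow T α x : ℂ) := by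
  rw [eval_monomial, Finsupp.prod_fintype _ _ (by simp), lamPow]
  push_cast
  rfl

/-- Extension by zero to sets of the wrong size makes all sums run over arbitrary finite sets, where
complements and insertions reindex freely. -/
theorem sum_altIdx {N : Type*} [AddCommMonoid N] {k : ℕ} (F : Finset (Fin (n + 1)) → N)
    (hF : ∀ s, s.card ≠ k → F s = 0) : ∑ σ : AltIdx k n, F σ.1 = ∑ s, F s := by
  rw [← Finset.sum_filter_of_ne (s := (Finset.univ : Finset (Finset (Fin (n + 1)))))
    (p := fun s => s.card = k) (fun s _ h => by by_contra h'; exact h (hF s h'))]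
  exact (Finset.sum_subtype _ (by simp) F).symm

theorem eval_coefPoly (T : Affine.Simplex ℝ V n) {r k : ℕ} (ω : MultiIdx r n → AltIdx k n → ℂ)
    (σ : AltIdx k n) (x : Carrier T) :
    eval (pt T x) (coefPoly ω σ.1) = ∑ α, ω α σ * (lamPow T α x : ℂ) := by
  rw [coefPoly, dif_pos σ.2, map_sum]
  simp only [eval_monomial_exponent]

theorem altSum_apply (T : Affine.Simplex ℝ V n) {k : ℕ} (c : Finset (Fin (n + 1)) → ℂ)
    (v : Fin k → Tangent T) : altSum T k c v = ∑ s, c s * dl T k s v := by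
  rw [altSum, altMap_sum_apply]
  rfl

theorem bubbleSum_eq_polyForm (T : Affine.Simplex ℝ V n) {r k : ℕ}
    (ω : MultiIdx r n → AltIdx k n → ℂ) :
    bubbleSum T ω = polyForm T k (bubbleCoef (coefPoly ω)) := by
  funext x
  ext v
  rw [polyForm, altSum_apply, ← sum_altIdx (k := k) _ fun s hs => by
    rw [dl_of_card_ne T hs]; exact mul_zero _]
  have h : bubbleSum T ω x v = ∑ α, ∑ σ : AltIdx k n,
      ω α σ * ((lamPow T α x : ℂ) * ((lamProd T σ.1ᶜ x : ℂ) * dl T k σ.1 v)) := by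
    simp only [bubbleSum, Finset.sum_apply, altMap_sum_apply]
    refine Finset.sum_congr rfl fun α _ => Finset.sum_congr rfl fun σ _ => ?_
    simp only [Pi.smul_apply, fmul, AlternatingMap.smul_apply, smul_eq_mul, Complex.real_smul,
      dlamAlt_eq_dl]
  rw [h, Finset.sum_comm]
  refine Finset.sum_congr rfl fun σ _ => ?_
  rw [bubbleCoef, map_mul, eval_coefPoly, map_prod, Finset.mul_sum, Finset.sum_mul]
  refine Finset.sum_congr rfl fun α _ => ?_
  simp only [eval_X, lamProd, pt]
  push_cast
  ring

theorem whitney_apply (T : Affine.Simplex ℝ V n) {l : ℕ} (ρ : AltIdx (l + 1) n) (x : Carrier T)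
    (v : Fin l → Tangent T) :
    whitney T ρ x v = ∑ p ∈ ρ.1, (sg p ρ.1 : ℂ) * pt T x p * dl T l (ρ.1.erase p) v := by
  simp only [whitney, Finset.sum_apply, altMap_sum_apply]
  rw [← Finset.sum_coe_sort ρ.1]
  refine Finset.sum_congr rfl fun p _ => ?_
  simp only [Pi.smul_apply, fmul, AlternatingMap.smul_apply, Complex.real_smul, dlamAlt_eq_dl,
    eps_erase_left, zsmul_eq_mul, pt, mul_assoc]
  rfl

theorem eval_kos_mulX (c : Finset (Fin (n + 1)) → MvPolynomial (Fin (n + 1)) ℂ)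
    (z : Fin (n + 1) → ℂ) (θ : Finset (Fin (n + 1))) :
    eval z (kos (mulX n) c θ) = ∑ p ∈ θ, (sg p θ : ℂ) * (z p * eval z (c (θ.erase p))) := by
  simp [kos]

theorem eval_kos_unitOp (c : Finset (Fin (n + 1)) → MvPolynomial (Fin (n + 1)) ℂ)
    (z : Fin (n + 1) → ℂ) (θ : Finset (Fin (n + 1))) :
    kos (unitOp _ ℂ) (fun s => eval z (c s)) θ = eval z (kos (unitOp _ _) c θ) := by
  simp [kos]

/-- The alternator $d\lambda_{\theta^c}$ arises in $\phi_{\sigma^c}$ exactly for $\sigma=\theta-p$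
with $p\in\theta$. By `eps_compl_erase_mul` the signs combine into those of `kos`, up to a factor
depending only on $\theta$. -/
theorem whitneySum_eq_polyForm (T : Affine.Simplex ℝ V n) {r k l : ℕ} (hkl : k + l = n)
    (ω : MultiIdx r n → AltIdx k n → ℂ) :
    whitneySum T hkl ω = polyForm T l (whitneyCoef k (coefPoly ω)) := by
  funext x
  ext v
  have h1 : whitneySum T hkl ω x v = ∑ σ : AltIdx k n, ∑ p ∈ σ.1ᶜ,
      ((eps σ.1 σ.1ᶜ * sg p σ.1ᶜ : ℤ) : ℂ) * (pt T x p * eval (pt T x) (coefPoly ω σ.1)) *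
        dl T l (insert p σ.1)ᶜ v := by
    simp only [whitneySum, Finset.sum_apply, altMap_sum_apply]
    rw [Finset.sum_comm]
    refine Finset.sum_congr rfl fun σ _ => ?_
    simp only [Pi.smul_apply, fmul, AlternatingMap.smul_apply, Complex.real_smul, smul_eq_mul,
      whitney_apply, AltIdx.compl, Finset.mul_sum, eval_coefPoly]
    rw [Finset.sum_comm]
    refine Finset.sum_congr rfl fun p _ => ?_
    rw [Finset.sum_mul]
    refine Finset.sum_congr rfl fun α _ => ?_
    rw [Finset.compl_insert]
    push_cast
    ring
  rw [h1, sum_altIdx (fun s => ∑ p ∈ sᶜ, ((eps s sᶜ * sg p sᶜ : ℤ) : ℂ) *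
      (pt T x p * eval (pt T x) (coefPoly ω s)) * dl T l (insert p s)ᶜ v)
      (fun s hs => by simp [coefPoly_of_card_ne ω hs]),
    ← sum_erase_eq_sum_insert fun p s s' => ((eps s sᶜ * sg p sᶜ : ℤ) : ℂ) *
      (pt T x p * eval (pt T x) (coefPoly ω s)) * dl T l s'ᶜ v, polyForm, altSum_apply]
  refine Fintype.sum_equiv (compl_involutive (α := Finset (Fin (n + 1)))).toPerm _ _ fun θ => ?_
  simp only [Function.Involutive.coe_toPerm, whitneyCoef, compl_compl, map_zsmul, eval_kos_mulX,
    Finset.smul_sum, Finset.sum_mul]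
  by_cases hθ : θᶜ.card = l
  · have hc : θ.card = k + 1 := by
      have := Finset.card_add_card_compl θ
      rw [Fintype.card_fin] at this
      omega
    refine Finset.sum_congr rfl fun p hp => ?_
    have := eps_compl_erase_mul hp
    rw [Finset.compl_erase, sg_insert_self, ← Finset.compl_erase, this, hc, Nat.add_sub_cancel,
      zsmul_eq_mul]
    push_cast
    ring
  · rw [dl_of_card_ne T hθ]
    simp

theorem thetaSum_eq_eval (T : Affine.Simplex ℝ V n) {r k : ℕ} (ω : MultiIdx r n → AltIdx k n → ℂ)
    (θ : AltIdx (k + 1) n) (x : Carrier T) :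
    thetaSum T ω θ x = eval (pt T x) (kos (mulX n) (coefPoly ω) θ.1) := by
  rw [thetaSum, eval_kos_mulX, Finset.sum_comm, ← Finset.sum_coe_sort θ.1]
  refine Finset.sum_congr rfl fun p _ => ?_
  have := eval_coefPoly T ω (θ.sub p.1 p.2) x
  rw [AltIdx.sub] at this
  rw [this, Finset.mul_sum, Finset.mul_sum]
  refine Finset.sum_congr rfl fun α _ => ?_
  rw [eps_erase_left]
  simp only [pt, AltIdx.sub]
  ring

/-- The complement of $\theta-p$ is $\theta^c+p$, so each bubble factor is the common $X_{\theta^c}$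
times the $X_p$ that the Koszul operator needs. -/
theorem kos_unitOp_bubbleCoef (a : Finset (Fin (n + 1)) → MvPolynomial (Fin (n + 1)) ℂ)
    (θ : Finset (Fin (n + 1))) :
    kos (unitOp _ _) (bubbleCoef a) θ = (∏ i ∈ θᶜ, X i) * kos (mulX n) a θ := by
  rw [kos, kos, Finset.mul_sum]
  refine Finset.sum_congr rfl fun p hp => ?_
  simp only [AddMonoidHom.id_apply, bubbleCoef, AddMonoidHom.coe_mulLeft]
  rw [Finset.compl_erase, Finset.prod_insert (by simpa using hp), mul_smul_comm]
  congr 1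
  ring

theorem polyForm_eq_zero (T : Affine.Simplex ℝ V n) {k : ℕ}
    {c : Finset (Fin (n + 1)) → MvPolynomial (Fin (n + 1)) ℂ}
    (h : ∀ θ : Finset (Fin (n + 1)), θ.card = k + 1 → kos (unitOp _ _) c θ = 0) :
    polyForm T k c = 0 := by
  funext x
  exact altSum_eq_zero T fun θ hθ => by rw [eval_kos_unitOp, h θ hθ, map_zero]

/-- The exterior product of forms of complementary degree on the edge vectors. -/
theorem altWedge_altSum_edge (T : Affine.Simplex ℝ V n) {k l : ℕ} (hkl : k + l = n)
    (c d : Finset (Fin (n + 1)) → ℂ) :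
    altWedge (altSum T k c) (altSum T l d) (fun i => edge T (Fin.cast hkl i)) =
      ∑ θ ∈ Finset.univ.filter (fun θ : Finset (Fin (n + 1)) => θ.card = k + 1),
        (eps θ θᶜ : ℂ) * d θᶜ * kos (unitOp _ ℂ) c θ := by
  subst hkl
  have hcard : ∀ θ : Finset (Fin (k + l + 1)), θᶜ.card = l ↔ θ.card = k + 1 := fun θ => by
    have := Finset.card_add_card_compl θ
    rw [Fintype.card_fin] at this
    omega
  have hW : ∀ θ : Finset (Fin (k + l + 1)), θ.card = k + 1 →
      ∑ s, c s * altWedge (dl T k s) (dl T l θᶜ) (edge T) =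
        (eps θ θᶜ : ℂ) * kos (unitOp _ ℂ) c θ := by
    intro θ hθ
    -- Only $s=\theta-p$ contributes: if $d\lambda_s\wedge d\lambda_{\theta^c}\ne0$ then $s$ is a
    -- subset of $\theta$ with one element fewer.
    rw [← Finset.sum_subset (Finset.subset_univ (θ.image fun p => θ.erase p))]
    · rw [Finset.sum_image (Finset.erase_injOn θ), kos, Finset.mul_sum]
      refine Finset.sum_congr rfl fun p hp => ?_
      have hd : Disjoint (θ.erase p) θᶜ :=
        disjoint_compl_right.mono_left (Finset.erase_subset _ _)
      have hu : θ.erase p ∪ θᶜ = Finset.univ.erase p := by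
        ext x
        by_cases hx : x = p
        · subst hx; simp [hp]
        · simp [hx, em]
      rw [altWedge_dl T (by rw [Finset.card_erase_of_mem hp, hθ]; rfl) ((hcard θ).2 hθ),
        if_pos hd, AlternatingMap.smul_apply, hu, dl_edge, zsmul_eq_mul, ← Int.cast_mul,
        eps_erase_compl_mul hp, zsmul_eq_mul, AddMonoidHom.id_apply]
      push_cast
      ring
    · intro s _ hs
      by_cases hc : s.card = k
      · rw [altWedge_dl T hc ((hcard θ).2 hθ), if_neg]
        · exact mul_zero _
        · intro hd
          have hsub : s ⊆ θ := by
            rw [← compl_compl θ]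
            exact fun x hx => Finset.mem_compl.2 (Finset.disjoint_left.1 hd hx)
          obtain ⟨p, hp⟩ : ∃ p, θ \ s = {p} := Finset.card_eq_one.1 (by
            rw [Finset.card_sdiff_of_subset hsub, hc, hθ]; omega)
          refine hs (Finset.mem_image.2 ⟨p, ?_, ?_⟩)
          · exact (Finset.mem_sdiff.1 (hp ▸ Finset.mem_singleton_self p : p ∈ θ \ s)).1
          · rw [Finset.erase_eq, ← hp, Finset.sdiff_sdiff_eq_self hsub]
      · rw [dl_of_card_ne T hc, ← altWedgeBilin_apply, map_zero]
        exact mul_zero _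
  have h1 : altWedge (altSum T k c) (altSum T l d) (edge T) =
      ∑ t, d t * ∑ s, c s * altWedge (dl T k s) (dl T l t) (edge T) := by
    rw [← altWedgeBilin_apply, altSum, altSum, map_sum, altMap_sum_apply]
    refine Finset.sum_congr rfl fun t _ => ?_
    rw [map_smul, AlternatingMap.smul_apply, LinearMap.map_sum₂, altMap_sum_apply, smul_eq_mul]
    congr 1
    refine Finset.sum_congr rfl fun s _ => ?_
    rw [LinearMap.map_smul₂, AlternatingMap.smul_apply, smul_eq_mul]
    rfl
  change altWedge (altSum T k c) (altSum T l d) (edge T) = _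
  rw [h1, ← Equiv.sum_comp (compl_involutive (α := Finset (Fin (k + l + 1)))).toPerm]
  simp only [Function.Involutive.coe_toPerm]
  rw [Finset.sum_filter]
  refine Finset.sum_congr rfl fun θ _ => ?_
  split_ifs with h
  · rw [hW θ h]
    ring
  · rw [dl_of_card_ne T (fun h' => h ((hcard θ).1 h'))]
    have : ∀ s, altWedge (dl T k s) (0 : (Tangent T) [⋀^Fin l]→ₗ[ℝ] ℂ) = 0 := fun s => by
      rw [← altWedgeBilin_apply, map_zero]
    simp [this]

/-- The coefficient polynomial of the top-degree form `polyForm c ∧ polyForm d`. -/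
noncomputable def topCoef (k : ℕ) (c d : Finset (Fin (n + 1)) → MvPolynomial (Fin (n + 1)) ℂ) :
    MvPolynomial (Fin (n + 1)) ℂ :=
  ∑ θ ∈ Finset.univ.filter (fun θ : Finset (Fin (n + 1)) => θ.card = k + 1),
    C (eps θ θᶜ : ℂ) * d θᶜ * kos (unitOp _ _) c θ

theorem wedge_polyForm_edge (T : Affine.Simplex ℝ V n) {k l : ℕ} (hkl : k + l = n)
    (c d : Finset (Fin (n + 1)) → MvPolynomial (Fin (n + 1)) ℂ) (x : Carrier T) :
    wedge (polyForm T k c) (polyForm T l d) x (fun i => edge T (Fin.cast hkl i)) =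
      eval (pt T x) (topCoef k c d) := by
  rw [wedge, polyForm, polyForm, altWedge_altSum_edge T hkl, topCoef, map_sum]
  refine Finset.sum_congr rfl fun θ _ => ?_
  rw [eval_kos_unitOp]
  simp

/-- The sign $\epsilon(\theta,\theta^c)$ enters once from the exterior product and once from the
Whitney coefficients. Its square is 1, leaving the uniform $(-1)^k$. -/
theorem topCoef_bubbleCoef_whitneyCoef (k : ℕ)
    (a b : Finset (Fin (n + 1)) → MvPolynomial (Fin (n + 1)) ℂ) :
    topCoef k (bubbleCoef a) (whitneyCoef k b) = (-1) ^ k *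
      ∑ θ ∈ Finset.univ.filter (fun θ : Finset (Fin (n + 1)) => θ.card = k + 1),
        (∏ i ∈ θᶜ, X i) * (kos (mulX n) a θ * kos (mulX n) b θ) := by
  rw [topCoef, Finset.mul_sum]
  refine Finset.sum_congr rfl fun θ _ => ?_
  rw [kos_unitOp_bubbleCoef, whitneyCoef, compl_compl, zsmul_eq_mul]
  have h : ((eps θ θᶜ : ℤ) : MvPolynomial (Fin (n + 1)) ℂ) * (eps θ θᶜ : ℤ) = 1 := by
    rw [← Int.cast_mul, eps_mul_self disjoint_compl_right, Int.cast_one]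
  have hC : C ((eps θ θᶜ : ℤ) : ℂ) = ((eps θ θᶜ : ℤ) : MvPolynomial (Fin (n + 1)) ℂ) := by simp
  rw [hC]
  push_cast
  linear_combination ((-1) ^ k * (∏ i ∈ θᶜ, X i) * kos (mulX n) a θ * kos (mulX n) b θ) * h

theorem lam_sum (T : Affine.Simplex ℝ V n) (x : Carrier T) : ∑ i, lam T i x = 1 :=
  AffineBasis.sum_coord_apply_eq_one _ _

/-- The signs square to 1 and $\sum_p\lambda_p=1$ remains: $\phi_T$ pulls back to the standard
volume form of the reference simplex. -/
theorem whitneyTop_edge (T : Affine.Simplex ℝ V n) (x : Carrier T) :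
    whitneyTop T x (edge T) = 1 := by
  rw [whitneyTop, whitney_apply]
  have : ∀ p ∈ (Finset.univ : Finset (Fin (n + 1))),
      (sg p Finset.univ : ℂ) * pt T x p * dl T n (Finset.univ.erase p) (edge T) = pt T x p := by
    intro p _
    rw [dl_edge]
    have h : (sg p Finset.univ : ℂ) * sg p Finset.univ = 1 := by
      rw [← Int.cast_mul, sg_mul_self, Int.cast_one]
    linear_combination (pt T x p) * h
  rw [Finset.sum_congr rfl this]
  change ∑ p, ((lam T p x : ℝ) : ℂ) = 1
  rw [← Complex.ofReal_sum, lam_sum, Complex.ofReal_one]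

end PolyForm

/-! ### Homogeneous polynomials on the simplex -/

section Homogeneous

open MvPolynomial

variable {ι : Type*} [Fintype ι]

theorem eval_mul_of_isHomogeneous {Q : MvPolynomial ι ℂ} {m : ℕ} (hQ : Q.IsHomogeneous m)
    (c : ℂ) (w : ι → ℂ) : eval (fun i => c * w i) Q = c ^ m * eval w Q := by
  rw [eval_eq', eval_eq', Finset.mul_sum]
  refine Finset.sum_congr rfl fun d hd => ?_
  have h : ∑ i, d i = m := by
    rw [hQ.degree_eq_sum_deg_support hd]
    exact (Finset.sum_subset (Finset.subset_univ _) (by simp)).symm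
  simp only [mul_pow, Finset.prod_mul_distrib, Finset.prod_pow_eq_pow_sum, h]
  ring

theorem eq_zero_of_eval_pos {ι : Type*} {Q : MvPolynomial ι ℂ}
    (h : ∀ w : ι → ℝ, (∀ i, 0 < w i) → eval (fun i => (w i : ℂ)) Q = 0) : Q = 0 := by
  refine funext_set (fun _ => Complex.ofReal '' Set.Ioi 0)
    (fun _ => (Set.Ioi_infinite 0).image Complex.ofReal_injective.injOn) fun x hx => ?_
  have hx' : ∀ i, ∃ w : ℝ, 0 < w ∧ (w : ℂ) = x i := fun i => by simpa using hx i (Set.mem_univ i)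
  choose w hw hwx using hx'
  rw [map_zero, ← h w hw]
  congr 2
  exact (_root_.funext hwx).symm

theorem eval_eq_zero_of_normalized {Q : MvPolynomial ι ℂ} {m : ℕ} (hQ : Q.IsHomogeneous m)
    {w : ι → ℝ} (hw : ∑ i, w i ≠ 0)
    (h : eval (fun i => ((w i / ∑ j, w j : ℝ) : ℂ)) Q = 0) : eval (fun i => (w i : ℂ)) Q = 0 := by
  have hs := eval_mul_of_isHomogeneous hQ ((∑ j, w j : ℝ) : ℂ)
    (fun i => ((w i / ∑ j, w j : ℝ) : ℂ))
  rw [h, mul_zero] at hs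
  rw [← hs]
  congr 2
  ext i
  rw [← Complex.ofReal_mul, mul_div_cancel₀ _ hw]

/-- Homogeneity spreads the zeros from the open simplex to the positive orthant, a product of
infinite sets. Without it $\sum_i X_i-1$ would be a counterexample. -/
theorem eq_zero_of_eval_simplex {Q : MvPolynomial ι ℂ} {m : ℕ} [Nonempty ι]
    (hQ : Q.IsHomogeneous m)
    (h : ∀ w : ι → ℝ, (∀ i, 0 < w i) → ∑ i, w i = 1 → eval (fun i => (w i : ℂ)) Q = 0) :
    Q = 0 := by
  refine eq_zero_of_eval_pos fun w hw => ?_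
  have hs : 0 < ∑ j, w j := Finset.sum_pos (fun i _ => hw i) Finset.univ_nonempty
  refine eval_eq_zero_of_normalized hQ hs.ne' (h _ (fun i => div_pos (hw i) hs) ?_)
  rw [← Finset.sum_div, div_self hs.ne']

/-- A homogeneous polynomial vanishing on a facet of the simplex is divisible by the
corresponding variable. -/
theorem X_dvd_of_eval_facet [DecidableEq ι] {Q : MvPolynomial ι ℂ} {m : ℕ}
    (hQ : Q.IsHomogeneous m) {i j : ι} (hij : j ≠ i)
    (h : ∀ w : ι → ℝ, (∀ i, 0 ≤ w i) → w i = 0 → ∑ i, w i = 1 →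
      eval (fun i => (w i : ℂ)) Q = 0) : X i ∣ Q := by
  set φ : MvPolynomial ι ℂ →ₐ[ℂ] MvPolynomial ι ℂ := aeval (Function.update X i 0) with hφ
  have h0 : φ Q = 0 := by
    refine eq_zero_of_eval_pos fun w hw => ?_
    have he : eval (fun i => (w i : ℂ)) (φ Q) =
        eval (fun a => ((Function.update w i 0 a : ℝ) : ℂ)) Q := by
      have : (aeval (fun i => (w i : ℂ))).comp φ =
          aeval (fun a => ((Function.update w i 0 a : ℝ) : ℂ)) := by
        refine algHom_ext fun a => ?_
        by_cases ha : a = i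
        · subst ha; simp [hφ]
        · simp [hφ, ha]
      have := DFunLike.congr_fun this Q
      simpa [aeval_eq_eval] using this
    rw [he]
    have hn : ∀ a, 0 ≤ Function.update w i 0 a := fun a => by
      by_cases ha : a = i
      · subst ha; simp
      · simp [ha, (hw a).le]
    have hs : 0 < ∑ a, Function.update w i 0 a :=
      Finset.sum_pos' (fun a _ => hn a) ⟨j, Finset.mem_univ _, by simp [hij, hw j]⟩
    refine eval_eq_zero_of_normalized hQ hs.ne' (h _ (fun a => div_nonneg (hn a) hs.le) ?_ ?_)
    · simp
    · rw [← Finset.sum_div, div_self hs.ne']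
  -- Setting $X_i=0$ is the identity modulo $X_i$, so $\varphi(Q)=0$ places $Q$ in the ideal
  -- $(X_i)$.
  have hmk : (Ideal.Quotient.mkₐ ℂ (Ideal.span {(X i : MvPolynomial ι ℂ)})).comp φ =
      Ideal.Quotient.mkₐ ℂ (Ideal.span {(X i : MvPolynomial ι ℂ)}) := by
    refine algHom_ext fun a => ?_
    by_cases ha : a = i
    · subst ha
      simp only [hφ, AlgHom.comp_apply, aeval_X, Function.update_self, map_zero]
      exact (Ideal.Quotient.eq_zero_iff_mem.2 (Ideal.mem_span_singleton_self _)).symm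
    · simp [hφ, ha]
  have h1 := DFunLike.congr_fun hmk Q
  rw [AlgHom.comp_apply, h0, map_zero] at h1
  exact Ideal.mem_span_singleton.1 (Ideal.Quotient.eq_zero_iff_mem.1 h1.symm)

end Homogeneous

/-! ### Integration over the reference simplex -/

section Integration

open MvPolynomial

variable {V : Type*} [AddCommGroup V] [Module ℝ V] {n : ℕ}

theorem lam_param (T : Affine.Simplex ℝ V n) (t : refSimplex n) (i : Fin (n + 1)) :
    lam T i (param T t) = (Fin.cons (1 - ∑ j, t.1 j) t.1 : Fin (n + 1) → ℝ) i := by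
  have h : toHull T (param T t) = (∑ j, t.1 j • vec T 0 j.succ) +ᵥ vertexBasis T 0 := by
    refine Subtype.ext ?_
    change T.points 0 + ∑ j, t.1 j • (T.points j.succ - T.points 0) =
      ((∑ j, t.1 j • vec T 0 j.succ : Tangent T) : V) + T.points 0
    rw [add_comm]
    congr 1
    simp [vec]
  rw [lam, h, AffineMap.map_vadd, map_sum]
  simp only [map_smul, coord_linear_vec, AffineBasis.coord_apply, smul_eq_mul, vadd_eq_add]
  refine Fin.cases ?_ (fun j => ?_) i
  · simp [(Fin.succ_ne_zero _).symm]
    ring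
  · simp [Fin.succ_ne_zero]

/-- Barycentric coordinates of a point of the reference simplex. -/
noncomputable def refPt (t : Fin n → ℝ) (i : Fin (n + 1)) : ℝ :=
  (Fin.cons (1 - ∑ j, t j) t : Fin (n + 1) → ℝ) i

theorem pt_param (T : Affine.Simplex ℝ V n) (t : refSimplex n) :
    pt T (param T t) = fun i => (refPt t.1 i : ℂ) := by
  ext i
  rw [pt, lam_param]
  rfl

theorem exists_lam_eq (T : Affine.Simplex ℝ V n) (w : Fin (n + 1) → ℝ) (hw : ∀ i, 0 ≤ w i)
    (hs : ∑ i, w i = 1) :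
    ∃ x : Carrier T, (∀ i, lam T i x = w i) ∧ x.1 = ∑ i, w i • T.points i := by
  rw [Fin.sum_univ_succ] at hs
  refine ⟨param T ⟨fun j => w j.succ, fun j => hw _, by linarith [hw 0]⟩, fun i => ?_, ?_⟩
  · rw [lam_param]
    refine Fin.cases ?_ (fun j => ?_) i
    · simp only [Fin.cons_zero]
      linarith
    · simp
  · simp only [param, Fin.sum_univ_succ, smul_sub, Finset.sum_sub_distrib, ← Finset.sum_smul]
    rw [eq_sub_of_add_eq hs, sub_smul, one_smul]
    abel

theorem isCompact_refSimplex (n : ℕ) : IsCompact (refSimplex n) := by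
  refine (isCompact_Icc (a := (0 : Fin n → ℝ)) (b := 1)).of_isClosed_subset ?_ ?_
  · have h1 : IsClosed {t : Fin n → ℝ | ∀ i, 0 ≤ t i} := by
      simp only [Set.ofPred_forall]
      exact isClosed_iInter fun i => isClosed_le continuous_const (continuous_apply i)
    exact h1.inter (isClosed_le (continuous_finsetSum _ fun i _ => continuous_apply i) continuous_const)
  · rintro t ⟨h0, h1⟩
    exact ⟨h0, fun i => (Finset.single_le_sum (fun j _ => h0 j) (Finset.mem_univ i)).trans h1⟩

theorem integrable_refSimplex {E : Type*} [NormedAddCommGroup E] {f : (Fin n → ℝ) → E}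
    (hf : Continuous f) :
    Integrable (fun t : refSimplex n => f t.1) (Measure.comap Subtype.val volume) :=
  (integrableOn_iff_comap_subtypeVal (isCompact_refSimplex n).measurableSet).1
    (hf.continuousOn.integrableOn_compact (isCompact_refSimplex n))

theorem continuous_refPt (i : Fin (n + 1)) : Continuous fun t : Fin n → ℝ => refPt t i := by
  refine Fin.cases ?_ (fun j => ?_) i
  · simp only [refPt, Fin.cons_zero]
    fun_prop
  · simp only [refPt, Fin.cons_succ]
    fun_prop

theorem continuous_eval_refPt (Q : MvPolynomial (Fin (n + 1)) ℂ) :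
    Continuous fun t : Fin n → ℝ => eval (fun i => (refPt t i : ℂ)) Q :=
  (MvPolynomial.continuous_eval Q).comp
    (continuous_pi fun i => Complex.continuous_ofReal.comp (continuous_refPt i))

theorem integrable_eval_param (T : Affine.Simplex ℝ V n) (Q : MvPolynomial (Fin (n + 1)) ℂ) :
    Integrable (fun t : refSimplex n => eval (pt T (param T t)) Q)
      (Measure.comap Subtype.val volume) := by
  simp only [pt_param]
  exact integrable_refSimplex (continuous_eval_refPt Q)

/-- A continuous nonnegative function on the reference simplex with vanishing integral
vanishes at all points with positive barycentric coordinates. -/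
theorem eq_zero_of_integral_refSimplex_eq_zero {f : (Fin n → ℝ) → ℝ} (hf : Continuous f)
    (h0 : ∀ t ∈ refSimplex n, 0 ≤ f t)
    (hi : ∫ t : refSimplex n, f t.1 ∂(Measure.comap Subtype.val volume) = 0)
    {t : Fin n → ℝ} (ht : ∀ i, 0 < t i) (hs : ∑ i, t i < 1) : f t = 0 := by
  have hm := (isCompact_refSimplex n).measurableSet
  rw [integral_subtype_comap hm f, setIntegral_eq_zero_iff_of_nonneg_ae
    (ae_restrict_of_forall_mem hm h0)
    (hf.continuousOn.integrableOn_compact (isCompact_refSimplex n))] at hi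
  set U : Set (Fin n → ℝ) := {t | (∀ i, 0 < t i) ∧ ∑ i, t i < 1} with hU
  have hUo : IsOpen U := by
    have h1 : IsOpen {t : Fin n → ℝ | ∀ i, 0 < t i} := by
      simp only [Set.ofPred_forall]
      exact isOpen_iInter_of_finite fun i => isOpen_lt continuous_const (continuous_apply i)
    exact h1.inter (isOpen_lt (continuous_finsetSum _ fun i _ => continuous_apply i) continuous_const)
  have hsub : U ⊆ refSimplex n := fun t ht => ⟨fun i => (ht.1 i).le, ht.2.le⟩
  have := Measure.eqOn_open_of_ae_eq (ae_restrict_of_ae_restrict_of_subset hsub hi) hUo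
    hf.continuousOn continuousOn_const
  exact this ⟨ht, hs⟩

/-! ### The integral pairing as a bilinear map and its value on coefficient families. -/

/-- Forms with polynomial coefficients. -/
noncomputable def polyFormLin (T : Affine.Simplex ℝ V n) (k : ℕ) :
    (Finset (Fin (n + 1)) → MvPolynomial (Fin (n + 1)) ℂ) →ₗ[ℂ] Form T k where
  toFun := polyForm T k
  map_add' b c := by
    funext x
    ext v
    simp [polyForm, altSum_apply, add_mul, Finset.sum_add_distrib]
  map_smul' z c := by
    funext x
    ext v
    simp [polyForm, altSum_apply, Finset.mul_sum, mul_assoc]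

/-- The integral of the exterior product, on forms with polynomial coefficients. -/
noncomputable def polyPairing (T : Affine.Simplex ℝ V n) {k l : ℕ} (hkl : k + l = n) :
    LinearMap.range (polyFormLin T k) →ₗ[ℂ] LinearMap.range (polyFormLin T l) →ₗ[ℂ] ℂ :=
  -- The integral is additive only on integrable integrands, hence the restriction of both arguments
  -- to polynomial forms.
  have hint (ω : LinearMap.range (polyFormLin T k)) (η : LinearMap.range (polyFormLin T l)) :
      Integrable (fun t : refSimplex n => wedge ω.1 η.1 (param T t)
        fun i => edge T (Fin.cast hkl i)) (Measure.comap Subtype.val volume) := by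
    obtain ⟨_, c, rfl⟩ := ω
    obtain ⟨_, d, rfl⟩ := η
    refine (integrable_eval_param T (topCoef k c d)).congr (Filter.Eventually.of_forall fun t => ?_)
    exact (wedge_polyForm_edge T hkl c d _).symm
  LinearMap.mk₂ ℂ (fun ω η => integral T hkl (wedge ω.1 η.1))
    (fun ω ω' η => by
      rw [integral, integral, integral, ← integral_add (hint ω η) (hint ω' η)]
      refine integral_congr_ae (Filter.Eventually.of_forall fun t => ?_)
      change altWedge (ω.1 (param T t) + ω'.1 (param T t)) _ _ = _
      rw [altWedge_add_left]
      rfl)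
    (fun z ω η => by
      rw [integral, integral, smul_eq_mul, ← integral_const_mul]
      refine integral_congr_ae (Filter.Eventually.of_forall fun t => ?_)
      change altWedge (z • ω.1 (param T t)) _ _ = _
      rw [altWedge_smul_left]
      rfl)
    (fun ω η η' => by
      rw [integral, integral, integral, ← integral_add (hint ω η) (hint ω η')]
      refine integral_congr_ae (Filter.Eventually.of_forall fun t => ?_)
      change altWedge _ (η.1 (param T t) + η'.1 (param T t)) _ = _
      rw [altWedge_add_right]
      rfl)
    (fun z ω η => by
      rw [integral, integral, smul_eq_mul, ← integral_const_mul]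
      refine integral_congr_ae (Filter.Eventually.of_forall fun t => ?_)
      change altWedge _ (z • η.1 (param T t)) _ = _
      rw [altWedge_smul_right]
      rfl)

theorem polyPairing_apply (T : Affine.Simplex ℝ V n) {k l : ℕ} (hkl : k + l = n)
    (ω : LinearMap.range (polyFormLin T k)) (η : LinearMap.range (polyFormLin T l)) :
    polyPairing T hkl ω η = integral T hkl (wedge ω.1 η.1) := rfl

/-- `bubbleSum` as a linear map. -/
noncomputable def bubbleLin (T : Affine.Simplex ℝ V n) (r k : ℕ) :
    (MultiIdx r n → AltIdx k n → ℂ) →ₗ[ℂ] LinearMap.range (polyFormLin T k) where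
  toFun ω := ⟨bubbleSum T ω, _, (bubbleSum_eq_polyForm T ω).symm⟩
  map_add' ω η := Subtype.ext (by simp [bubbleSum, add_smul, Finset.sum_add_distrib])
  map_smul' z ω := Subtype.ext (by simp [bubbleSum, mul_smul, Finset.smul_sum])

/-- `whitneySum` as a linear map. -/
noncomputable def whitneyLin (T : Affine.Simplex ℝ V n) (r : ℕ) {k l : ℕ} (hkl : k + l = n) :
    (MultiIdx r n → AltIdx k n → ℂ) →ₗ[ℂ] LinearMap.range (polyFormLin T l) where
  toFun ω := ⟨whitneySum T hkl ω, _, (whitneySum_eq_polyForm T hkl ω).symm⟩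
  map_add' ω η := Subtype.ext (by simp [whitneySum, add_smul, mul_add, Finset.sum_add_distrib])
  map_smul' z ω := Subtype.ext (by
    simp [whitneySum, Finset.smul_sum, smul_smul, mul_left_comm])

/-- The family with a single nonzero entry. -/
noncomputable def singleCoef {r k n : ℕ} (α : MultiIdx r n) (σ : AltIdx k n) (z : ℂ) :
    MultiIdx r n → AltIdx k n → ℂ := Pi.single α (Pi.single σ z)

theorem sum_singleCoef {r k n : ℕ} (ω : MultiIdx r n → AltIdx k n → ℂ) :
    ∑ α, ∑ σ, singleCoef α σ (ω α σ) = ω := by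
  ext α σ
  simp only [singleCoef, Finset.sum_apply]
  rw [Finset.sum_eq_single α, Finset.sum_eq_single σ]
  · simp
  · intro b _ hb
    simp [hb.symm]
  · simp
  · intro b _ hb
    simp [hb.symm]
  · simp

theorem bubbleSum_singleCoef (T : Affine.Simplex ℝ V n) {r k : ℕ} (α : MultiIdx r n)
    (σ : AltIdx k n) (z : ℂ) : bubbleSum T (singleCoef α σ z) =
      z • fmul (lamPow T α) (fmul (lamProd T σ.1ᶜ) (dlamAlt T σ)) := by
  rw [bubbleSum, Finset.sum_eq_single α, Finset.sum_eq_single σ]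
  · simp [singleCoef]
  · intro b _ hb
    simp [singleCoef, hb]
  · simp
  · intro b _ hb
    simp [singleCoef, hb]
  · simp

theorem whitneySum_singleCoef (T : Affine.Simplex ℝ V n) {r k l : ℕ} (hkl : k + l = n)
    (α : MultiIdx r n) (σ : AltIdx k n) (z : ℂ) : whitneySum T hkl (singleCoef α σ z) =
      ((eps σ.1 σ.1ᶜ : ℂ) * z) • fmul (lamPow T α) (whitney T (σ.compl hkl)) := by
  rw [whitneySum, Finset.sum_eq_single α, Finset.sum_eq_single σ]
  · simp [singleCoef]
  · intro b _ hb
    simp [singleCoef, hb]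
  · simp
  · intro b _ hb
    simp [singleCoef, hb]
  · simp

/-- The complex conjugate family. -/
noncomputable def conjCoef {r k n : ℕ} (ω : MultiIdx r n → AltIdx k n → ℂ) :
    MultiIdx r n → AltIdx k n → ℂ := fun α σ => starRingEnd ℂ (ω α σ)

theorem conjCoef_conjCoef {r k n : ℕ} (ω : MultiIdx r n → AltIdx k n → ℂ) :
    conjCoef (conjCoef ω) = ω := by
  ext α σ
  simp [conjCoef]

theorem pairingSum_eq_polyPairing (T : Affine.Simplex ℝ V n) {r k l : ℕ} (hkl : k + l = n)
    (ω : MultiIdx r n → AltIdx k n → ℂ) :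
    pairingSum T hkl ω =
      polyPairing T hkl (bubbleLin T r k ω) (whitneyLin T r hkl (conjCoef ω)) := by
  have h (η : MultiIdx r n → AltIdx k n → ℂ) :
      polyPairing T hkl (bubbleLin T r k ω) (whitneyLin T r hkl η) =
        ∑ α, ∑ σ, ∑ β, ∑ ρ, polyPairing T hkl (bubbleLin T r k (singleCoef α σ (ω α σ)))
          (whitneyLin T r hkl (singleCoef β ρ (η β ρ))) := by
    conv_lhs => rw [← sum_singleCoef ω]
    simp only [map_sum, LinearMap.sum_apply]
    refine Finset.sum_congr rfl fun α _ => Finset.sum_congr rfl fun σ _ => ?_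
    conv_lhs => rw [← sum_singleCoef η]
    simp only [map_sum]
  rw [h, pairingSum]
  refine Finset.sum_congr rfl fun α _ => ?_
  rw [Finset.sum_comm]
  refine Finset.sum_congr rfl fun σ _ => Finset.sum_congr rfl fun β _ =>
    Finset.sum_congr rfl fun ρ _ => ?_
  rw [polyPairing_apply]
  change _ = integral T hkl (wedge (bubbleSum T (singleCoef α σ (ω α σ)))
    (whitneySum T hkl (singleCoef β ρ (conjCoef ω β ρ))))
  rw [bubbleSum_singleCoef, whitneySum_singleCoef]
  rfl

/-- The pairing is symmetric in the two families up to the weights $\lambda_{\theta^c}$ and the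
global sign: both enter only through their Koszul images. -/
theorem pairing_bubble_whitney (T : Affine.Simplex ℝ V n) {r k l : ℕ} (hkl : k + l = n)
    (ω η : MultiIdx r n → AltIdx k n → ℂ) :
    integral T hkl (wedge (bubbleSum T ω) (whitneySum T hkl η)) =
      (-1) ^ k * ∑ θ : AltIdx (k + 1) n, ∫ t : refSimplex n,
        eval (pt T (param T t)) ((∏ i ∈ θ.1ᶜ, X i) * (kos (mulX n) (coefPoly ω) θ.1 *
          kos (mulX n) (coefPoly η) θ.1)) ∂(Measure.comap Subtype.val volume) := by
  rw [bubbleSum_eq_polyForm, whitneySum_eq_polyForm, integral]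
  simp only [wedge_polyForm_edge, topCoef_bubbleCoef_whitneyCoef]
  rw [← integral_finsetSum _ fun θ _ => integrable_eval_param T _, ← integral_const_mul]
  refine integral_congr_ae (Filter.Eventually.of_forall fun t => ?_)
  simp only [map_mul, map_pow, map_neg, map_one, map_sum]
  congr 1
  exact Finset.sum_subtype _ (by simp) _

theorem thetaSum_conjCoef (T : Affine.Simplex ℝ V n) {r k : ℕ}
    (ω : MultiIdx r n → AltIdx k n → ℂ) (θ : AltIdx (k + 1) n) (x : Carrier T) :
    thetaSum T (conjCoef ω) θ x = starRingEnd ℂ (thetaSum T ω θ x) := by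
  simp [thetaSum, conjCoef]

theorem eval_kos_mul_conj (T : Affine.Simplex ℝ V n) {r k : ℕ}
    (ω : MultiIdx r n → AltIdx k n → ℂ) (θ : AltIdx (k + 1) n) (x : Carrier T) :
    eval (pt T x) ((∏ i ∈ θ.1ᶜ, X i) * (kos (mulX n) (coefPoly ω) θ.1 *
      kos (mulX n) (coefPoly (conjCoef ω)) θ.1)) =
    ((lamProd T θ.1ᶜ x * ‖thetaSum T ω θ x‖ ^ 2 : ℝ) : ℂ) := by
  rw [map_mul, map_mul, ← thetaSum_eq_eval, ← thetaSum_eq_eval, thetaSum_conjCoef,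
    Complex.mul_conj, Complex.normSq_eq_norm_sq, map_prod]
  simp only [eval_X, lamProd, pt]
  push_cast
  rfl

/-- The value of the pairing as a sum of weighted norms. -/
theorem pairingSum_eq (T : Affine.Simplex ℝ V n) {r k l : ℕ} (hkl : k + l = n)
    (ω : MultiIdx r n → AltIdx k n → ℂ) :
    pairingSum T hkl ω = (-1) ^ k * ∑ θ : AltIdx (k + 1) n,
      ((∫ t : refSimplex n, lamProd T θ.1ᶜ (param T t) * ‖thetaSum T ω θ (param T t)‖ ^ 2
        ∂(Measure.comap Subtype.val volume) : ℝ) : ℂ) := by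
  rw [pairingSum_eq_polyPairing, polyPairing_apply]
  refine (pairing_bubble_whitney T hkl ω (conjCoef ω)).trans ?_
  simp only [eval_kos_mul_conj, integral_complex_ofReal]

theorem integral_fmul_whitneyTop (T : Affine.Simplex ℝ V n) (f : Carrier T → ℝ) :
    integral T rfl (fmul f (whitneyTop T)) =
      ((∫ t : refSimplex n, f (param T t) ∂(Measure.comap Subtype.val volume) : ℝ) : ℂ) := by
  rw [integral, ← integral_complex_ofReal]
  refine integral_congr_ae (Filter.Eventually.of_forall fun t => ?_)
  change f (param T t) • whitneyTop T (param T t) (edge T) = _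
  rw [whitneyTop_edge, Complex.real_smul, mul_one]

theorem lam_nonneg_param (T : Affine.Simplex ℝ V n) (t : refSimplex n) (i : Fin (n + 1)) :
    0 ≤ lam T i (param T t) := by
  rw [lam_param]
  refine Fin.cases ?_ (fun j => ?_) i
  · simpa using t.2.2
  · simpa using t.2.1 j

theorem isHomogeneous_coefPoly {r k n : ℕ} (ω : MultiIdx r n → AltIdx k n → ℂ)
    (s : Finset (Fin (n + 1))) : (coefPoly ω s).IsHomogeneous r := by
  unfold coefPoly
  split_ifs with h
  · refine IsHomogeneous.sum _ _ _ fun α _ => isHomogeneous_monomial _ ?_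
    rw [Finsupp.degree_eq_sum]
    exact α.2
  · exact isHomogeneous_zero _ _ _

theorem isHomogeneous_kos_mulX {r n : ℕ}
    {a : Finset (Fin (n + 1)) → MvPolynomial (Fin (n + 1)) ℂ} (ha : ∀ s, (a s).IsHomogeneous r)
    (θ : Finset (Fin (n + 1))) : (kos (mulX n) a θ).IsHomogeneous (r + 1) := by
  refine IsHomogeneous.sum _ _ _ fun p _ => ?_
  rw [← mem_homogeneousSubmodule]
  refine zsmul_mem ?_ _
  rw [mem_homogeneousSubmodule, add_comm r 1]
  exact (isHomogeneous_X _ _).mul (ha _)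

/-- The pairing vanishes only if all the polynomials in its squares vanish. -/
theorem kos_eq_zero_of_pairingSum_eq_zero (T : Affine.Simplex ℝ V n) {r k l : ℕ}
    (hkl : k + l = n) (ω : MultiIdx r n → AltIdx k n → ℂ) (h : pairingSum T hkl ω = 0)
    (θ : AltIdx (k + 1) n) : kos (mulX n) (coefPoly ω) θ.1 = 0 := by
  rw [pairingSum_eq] at h
  -- Without the sign $(-1)^k$ this is a vanishing sum of integrals of nonnegative functions, so
  -- each integral vanishes.
  have h1 := (mul_eq_zero.1 h).resolve_left (by simp)
  rw [← Complex.ofReal_sum, Complex.ofReal_eq_zero,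
    Finset.sum_eq_zero_iff_of_nonneg fun θ _ => integral_nonneg fun t =>
      mul_nonneg (Finset.prod_nonneg fun i _ => lam_nonneg_param T t i) (sq_nonneg _)] at h1
  have h2 := h1 θ (Finset.mem_univ _)
  set Q := kos (mulX n) (coefPoly ω) θ.1 with hQ
  have hfun : ∀ t : refSimplex n,
      lamProd T θ.1ᶜ (param T t) * ‖thetaSum T ω θ (param T t)‖ ^ 2 =
      (fun t : Fin n → ℝ => (∏ i ∈ θ.1ᶜ, refPt t i) *
        ‖eval (fun i => (refPt t i : ℂ)) Q‖ ^ 2) t.1 := by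
    intro t
    simp only [lamProd, lam_param, thetaSum_eq_eval, pt_param]
    rfl
  simp only [hfun] at h2
  have hc : Continuous fun t : Fin n → ℝ => (∏ i ∈ θ.1ᶜ, refPt t i) *
      ‖eval (fun i => (refPt t i : ℂ)) Q‖ ^ 2 :=
    (continuous_finsetProd _ fun i _ => continuous_refPt i).mul
      ((continuous_eval_refPt Q).norm.pow 2)
  refine eq_zero_of_eval_simplex (isHomogeneous_kos_mulX (isHomogeneous_coefPoly ω) θ.1)
    fun w hw hs => ?_
  have hs' := hs
  rw [Fin.sum_univ_succ] at hs'
  have hz := eq_zero_of_integral_refSimplex_eq_zero hc (fun t ht =>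
    mul_nonneg (Finset.prod_nonneg fun i _ => by
      have := lam_nonneg_param T ⟨t, ht⟩ i
      rwa [lam_param] at this) (sq_nonneg _)) h2 (t := fun j => w j.succ) (fun i => hw _)
    (by linarith [hw 0])
  have hw' : refPt (fun j => w j.succ) = w := by
    ext i
    refine Fin.cases ?_ (fun j => ?_) i
    · simp only [refPt, Fin.cons_zero]
      linarith
    · simp [refPt]
  simp only [hw'] at hz
  have := (mul_eq_zero.1 hz).resolve_left (Finset.prod_pos fun i _ => hw i).ne'
  exact norm_eq_zero.1 (pow_eq_zero_iff (two_ne_zero)|>.1 this)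

end Integration

/-! ### The coefficient conditions -/

section Conditions

open MvPolynomial

variable {r k l n : ℕ}

theorem MultiIdx.mem_supp {α : MultiIdx r n} {i : Fin (n + 1)} : i ∈ α.supp ↔ α.1 i ≠ 0 := by
  simp [MultiIdx.supp, Nat.pos_iff_ne_zero]

theorem MultiIdx.support_exponent (α : MultiIdx r n) : α.exponent.support = α.supp := by
  ext i
  rw [MultiIdx.mem_supp, Finsupp.mem_support_iff]
  rfl

theorem MultiIdx.exponent_injective :
    Function.Injective (MultiIdx.exponent : MultiIdx r n → Fin (n + 1) →₀ ℕ) :=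
  fun _ _ h => Subtype.ext (Finsupp.equivFunOnFinite.symm.injective h)

theorem MultiIdx.exists_exponent_eq {d : Fin (n + 1) →₀ ℕ} (hd : d.degree = r) :
    ∃ α : MultiIdx r n, α.exponent = d :=
  ⟨⟨d, by rw [← hd, Finsupp.degree_eq_sum]⟩, by ext; rfl⟩

theorem MultiIdx.exponent_add (α : MultiIdx r n) (p : Fin (n + 1)) :
    (α.add p).exponent = α.exponent + Finsupp.single p 1 := by
  ext i
  change Function.update α.1 p (α.1 p + 1) i = α.1 i + Finsupp.single p 1 i
  by_cases h : i = p
  · subst h; simp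
  · simp [h]

theorem MultiIdx.exponent_sub (β : MultiIdx (r + 1) n) (p : Fin (n + 1)) (hp : p ∈ β.supp) :
    (β.sub p hp).exponent = β.exponent - Finsupp.single p 1 := by
  ext i
  change Function.update β.1 p (β.1 p - 1) i = β.1 i - Finsupp.single p 1 i
  by_cases h : i = p
  · subst h; simp
  · simp [h]

theorem coeff_coefPoly (ω : MultiIdx r n → AltIdx k n → ℂ) (α : MultiIdx r n) (σ : AltIdx k n) :
    coeff α.exponent (coefPoly ω σ.1) = ω α σ := by
  rw [coefPoly, dif_pos σ.2, coeff_sum, Finset.sum_eq_single α]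
  · simp
  · intro β _ hβ
    rw [coeff_monomial, if_neg fun h => hβ (MultiIdx.exponent_injective h)]
  · simp

theorem coeff_kos_mulX (a : Finset (Fin (n + 1)) → MvPolynomial (Fin (n + 1)) ℂ)
    (θ : Finset (Fin (n + 1))) (d : Fin (n + 1) →₀ ℕ) :
    coeff d (kos (mulX n) a θ) =
      ∑ p ∈ θ ∩ d.support, (sg p θ : ℂ) * coeff (d - Finsupp.single p 1) (a (θ.erase p)) := by
  rw [kos, coeff_sum, ← Finset.filter_mem_eq_inter, Finset.sum_filter]
  refine Finset.sum_congr rfl fun p _ => ?_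
  rw [coeff_smul, AddMonoidHom.coe_mulLeft, coeff_X_mul', zsmul_eq_mul, mul_ite, mul_zero]

theorem coeff_kos_coefPoly (ω : MultiIdx r n → AltIdx k n → ℂ) (β : MultiIdx (r + 1) n)
    (θ : AltIdx (k + 1) n) :
    coeff β.exponent (kos (mulX n) (coefPoly ω) θ.1) =
      ∑ p : (θ.1 ∩ β.supp : Finset (Fin (n + 1))), (sg p.1 θ.1 : ℂ) *
        ω (β.sub p.1 (Finset.mem_inter.1 p.2).2) (θ.sub p.1 (Finset.mem_inter.1 p.2).1) := by
  rw [coeff_kos_mulX, MultiIdx.support_exponent, ← Finset.sum_coe_sort (θ.1 ∩ β.supp)]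
  refine Finset.sum_congr rfl fun p _ => ?_
  rw [← MultiIdx.exponent_sub β p.1 (Finset.mem_inter.1 p.2).2, ← coeff_coefPoly ω]
  rfl

/-- Up to $(-1)^k$, from moving $p$ past the $k$ entries of $\theta-p$, the condition lists the
coefficients of degree $r+1$. Homogeneity makes all others zero. -/
theorem cycleCondition_iff (ω : MultiIdx r n → AltIdx k n → ℂ) :
    CycleCondition ω ↔ ∀ θ : AltIdx (k + 1) n, kos (mulX n) (coefPoly ω) θ.1 = 0 := by
  have h : ∀ (β : MultiIdx (r + 1) n) (θ : AltIdx (k + 1) n),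
      ∑ p : (θ.1 ∩ β.supp : Finset (Fin (n + 1))), (eps (θ.1.erase p.1) {p.1} : ℂ) *
        ω (β.sub p.1 (Finset.mem_inter.1 p.2).2) (θ.sub p.1 (Finset.mem_inter.1 p.2).1) =
      (-1) ^ k * coeff β.exponent (kos (mulX n) (coefPoly ω) θ.1) := by
    intro β θ
    rw [coeff_kos_coefPoly, Finset.mul_sum]
    refine Finset.sum_congr rfl fun p _ => ?_
    rw [eps_erase_right (Finset.mem_inter.1 p.2).1, θ.2, Nat.add_sub_cancel]
    push_cast
    ring
  unfold CycleCondition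
  simp only [h, mul_eq_zero, neg_eq_zero, one_ne_zero, pow_eq_zero_iff',
    false_and, false_or]
  constructor
  · intro h θ
    ext d
    rw [coeff_zero]
    by_cases hd : d.degree = r + 1
    · obtain ⟨β, rfl⟩ := MultiIdx.exists_exponent_eq hd
      exact h β θ
    · exact (isHomogeneous_kos_mulX (isHomogeneous_coefPoly ω) θ.1).coeff_eq_zero hd
  · intro h β θ
    rw [h θ, coeff_zero]

theorem cycleCondition_conjCoef {ω : MultiIdx r n → AltIdx k n → ℂ}
    (h : CycleCondition (conjCoef ω)) : CycleCondition ω := by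
  intro β θ
  have := congrArg (starRingEnd ℂ) (h β θ)
  simpa [conjCoef] using this

/-- The expressions in `MinCondition` are the coefficients in the cycle condition at `α + j` and
`σ + j`, where `j` is the minimum of the complement of `σ`. -/
theorem minCondition_expr (hkl : k + l = n) (ω : MultiIdx r n → AltIdx k n → ℂ)
    (α : MultiIdx r n) (σ : AltIdx k n) :
    ω α σ - ∑ q : (σ.1 ∩ α.supp : Finset (Fin (n + 1))),
      (eps {σ.minCompl hkl} (σ.1.erase q.1) : ℂ) * (eps {q.1} (σ.1.erase q.1) : ℂ) *
        ω ((α.add (σ.minCompl hkl)).sub q.1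
            (α.mem_supp_add _ _ (Finset.mem_inter.1 q.2).2))
          ((σ.add (σ.minCompl hkl) (σ.minCompl_notMem hkl)).sub q.1
            (Finset.mem_insert_of_mem (Finset.mem_inter.1 q.2).1)) =
    (sg (σ.minCompl hkl) σ.1 : ℂ) * coeff (α.add (σ.minCompl hkl)).exponent
      (kos (mulX n) (coefPoly ω) (insert (σ.minCompl hkl) σ.1)) := by
  have hj := σ.minCompl_notMem hkl
  set j := σ.minCompl hkl with hjdef
  -- The index $j$ always occurs, since $\alpha+j$ is positive there; it yields the isolated term
  -- $\omega_{\alpha\sigma}$.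
  have hsupp : insert j σ.1 ∩ (α.add j).exponent.support = insert j (σ.1 ∩ α.supp) := by
    ext i
    rw [MultiIdx.exponent_add]
    by_cases hi : i = j
    · subst hi; simp
    · simp only [Finset.mem_inter, Finset.mem_insert, hi, false_or, Finsupp.mem_support_iff,
        Finsupp.add_apply, MultiIdx.mem_supp]
      rw [Finsupp.single_eq_of_ne hi, add_zero]
      rfl
  rw [coeff_kos_mulX, hsupp, Finset.sum_insert (by simp [hj]), MultiIdx.exponent_add,
    add_tsub_cancel_right, Finset.erase_insert hj, coeff_coefPoly, sg_insert_self, mul_add,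
    ← mul_assoc, ← Int.cast_mul, sg_mul_self, Int.cast_one, one_mul, sub_eq_add_neg,
    ← Finset.sum_neg_distrib, Finset.mul_sum, ← Finset.sum_coe_sort (σ.1 ∩ α.supp)]
  congr 1
  refine Finset.sum_congr rfl fun q _ => ?_
  have hq := (Finset.mem_inter.1 q.2).1
  rw [eps_singleton_left (fun h => hj (Finset.mem_of_mem_erase h)), eps_erase_left, ← mul_assoc,
    ← Int.cast_mul, ← Int.cast_mul, sg_cross hj hq, ← coeff_coefPoly ω, MultiIdx.exponent_sub,
    MultiIdx.exponent_add, mul_comm (sg q.1 σ.1)]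
  push_cast
  rw [neg_mul]
  rfl

theorem minCondition_of_cycleCondition (hkl : k + l = n) {ω : MultiIdx r n → AltIdx k n → ℂ}
    (h : CycleCondition ω) : MinCondition hkl ω := by
  intro α σ _
  have h0 : kos (mulX n) (coefPoly ω) (insert (σ.minCompl hkl) σ.1) = 0 :=
    (cycleCondition_iff ω).1 h (σ.add _ (σ.minCompl_notMem hkl))
  rw [minCondition_expr, h0, coeff_zero, mul_zero]

/-- These are the coefficients that `MinCondition` controls directly. If $m$ is the minimum of
$[\beta]$ and $\theta$ contains all indices up to $m$, then $\sigma=\theta-m$ has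
$\lfloor\sigma^c\rfloor=m$, and $\alpha=\beta-m$ has $\lfloor\alpha\rfloor\ge m$. -/
theorem coeff_kos_eq_zero_of_minCondition (hkl : k + l = n)
    {ω : MultiIdx r n → AltIdx k n → ℂ} (h : MinCondition hkl ω) (β : MultiIdx (r + 1) n)
    (θ : AltIdx (k + 1) n) {m : Fin (n + 1)} (hmβ : m ∈ β.supp) (hmθ : ∀ i ≤ m, i ∈ θ.1)
    (hm : ∀ i ∈ β.supp, m ≤ i) : coeff β.exponent (kos (mulX n) (coefPoly ω) θ.1) = 0 := by
  set α := β.sub m hmβ with hα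
  set σ := θ.sub m (hmθ m le_rfl) with hσ
  have hσ1 : σ.1 = θ.1.erase m := rfl
  have hmσ : m ∈ σ.1ᶜ := by simp [hσ1]
  have hlow : ∀ i ∈ σ.1ᶜ, m ≤ i := by
    intro i hi
    by_contra hlt
    rw [not_le] at hlt
    rw [Finset.mem_compl, hσ1, Finset.mem_erase, not_and] at hi
    exact hi hlt.ne (hmθ i hlt.le)
  have hj : σ.minCompl hkl = m :=
    le_antisymm (Finset.min'_le _ _ hmσ) (Finset.le_min' _ _ _ hlow)
  have hmin : (σ.1ᶜ).min ≤ α.supp.min := by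
    refine (Finset.min_le hmσ).trans (Finset.le_min fun i hi => ?_)
    refine WithTop.coe_le_coe.2 (hm i ?_)
    rw [← MultiIdx.support_exponent, hα, MultiIdx.exponent_sub, Finsupp.mem_support_iff,
      Finsupp.tsub_apply] at hi
    rw [MultiIdx.mem_supp]
    intro h0
    apply hi
    change β.1 i - _ = 0
    rw [h0, zero_tsub]
  have h1 := h α σ hmin
  rw [minCondition_expr, hj] at h1
  have h2 : (α.add m).exponent = β.exponent := by
    rw [MultiIdx.exponent_add, hα, MultiIdx.exponent_sub, tsub_add_cancel_of_le]
    rw [Finsupp.single_le_iff]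
    exact Nat.one_le_iff_ne_zero.2 (MultiIdx.mem_supp.1 hmβ)
  rw [h2, hσ1, Finset.insert_erase (hmθ m le_rfl)] at h1
  refine (mul_eq_zero.1 h1).resolve_left fun h0 => ?_
  have := sg_mul_self m (θ.1.erase m)
  rw [Int.cast_eq_zero.1 h0] at this
  simp at this

/-- If $\theta$ misses some index up to $m=\lfloor\beta\rfloor$, let $j$ be its smallest missing
index. The coefficient of $\beta+j$ in $(K^2a)_{\theta+j}=0$ contains the wanted one as its term
$p=j$. Every other term has $p>j$ and belongs to $(\beta+j-p,\ \theta+j-p)$, a pair with minimum $j$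
covered by the previous lemma. -/
theorem cycleCondition_of_minCondition (hkl : k + l = n) {ω : MultiIdx r n → AltIdx k n → ℂ}
    (h : MinCondition hkl ω) : CycleCondition ω := by
  rw [cycleCondition_iff]
  intro θ
  ext d
  rw [coeff_zero]
  by_cases hd : d.degree = r + 1
  swap
  · exact (isHomogeneous_kos_mulX (isHomogeneous_coefPoly ω) θ.1).coeff_eq_zero hd
  obtain ⟨β, rfl⟩ := MultiIdx.exists_exponent_eq hd
  have hne : β.supp.Nonempty := by
    rw [← MultiIdx.support_exponent, Finsupp.support_nonempty_iff]
    intro h0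
    simp [h0] at hd
  set m := β.supp.min' hne with hm
  by_cases hθ : ∀ i ≤ m, i ∈ θ.1
  · exact coeff_kos_eq_zero_of_minCondition hkl h β θ (β.supp.min'_mem hne) hθ
      fun i hi => β.supp.min'_le i hi
  push Not at hθ
  obtain ⟨i₀, hi₀m, hi₀⟩ := hθ
  have hcne : (θ.1ᶜ).Nonempty := ⟨i₀, Finset.mem_compl.2 hi₀⟩
  set j := (θ.1ᶜ).min' hcne with hj
  have hjθ : j ∉ θ.1 := Finset.mem_compl.1 ((θ.1ᶜ).min'_mem hcne)
  have hjm : j ≤ m := ((θ.1ᶜ).min'_le i₀ (Finset.mem_compl.2 hi₀)).trans hi₀m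
  have hlow : ∀ i < j, i ∈ θ.1 := by
    intro i hi
    by_contra hi'
    exact absurd ((θ.1ᶜ).min'_le i (Finset.mem_compl.2 hi')) (not_le.2 hi)
  have hkk := congrFun (kos_kos (mulX n) (fun p q x => mul_left_comm _ _ _) (coefPoly ω))
    (insert j θ.1)
  have hc := congrArg (coeff (β.add j).exponent) hkk
  rw [coeff_kos_mulX, Pi.zero_apply, coeff_zero] at hc
  rw [Finset.sum_eq_single j] at hc
  · rw [MultiIdx.exponent_add, add_tsub_cancel_right, Finset.erase_insert hjθ] at hc
    refine (mul_eq_zero.1 hc).resolve_left fun h0 => ?_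
    have := sg_mul_self j (insert j θ.1)
    rw [Int.cast_eq_zero.1 h0] at this
    simp at this
  · intro p hp hpj
    rw [Finset.mem_inter, Finset.mem_insert, MultiIdx.support_exponent] at hp
    have hpθ := hp.1.resolve_left hpj
    rw [← MultiIdx.exponent_sub _ _ hp.2]
    have hpβ : p ∈ β.supp := by
      have := hp.2
      rw [← MultiIdx.support_exponent, MultiIdx.exponent_add, Finsupp.mem_support_iff,
        Finsupp.add_apply, Finsupp.single_eq_of_ne hpj, add_zero] at this
      exact MultiIdx.mem_supp.2 this
    have hjp : j < p := lt_of_le_of_ne (hjm.trans (β.supp.min'_le p hpβ)) (Ne.symm hpj)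
    have := coeff_kos_eq_zero_of_minCondition hkl h ((β.add j).sub p hp.2)
      ((θ.add j hjθ).sub p (Finset.mem_insert_of_mem hpθ)) (m := j) ?_ ?_ ?_
    · exact (congrArg _ this).trans (mul_zero _)
    · rw [← MultiIdx.support_exponent, MultiIdx.exponent_sub, MultiIdx.exponent_add]
      simp [Finsupp.single_eq_of_ne hpj.symm]
    · intro i hi
      change i ∈ (insert j θ.1).erase p
      rw [Finset.mem_erase, Finset.mem_insert]
      refine ⟨(hi.trans_lt hjp).ne, ?_⟩
      rcases hi.eq_or_lt with h' | h'
      · exact Or.inl h'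
      · exact Or.inr (hlow i h')
    · intro i hi
      rw [← MultiIdx.support_exponent, MultiIdx.exponent_sub, MultiIdx.exponent_add,
        Finsupp.mem_support_iff, Finsupp.tsub_apply, Finsupp.add_apply] at hi
      by_cases hij : i = j
      · exact hij.ge
      · rw [Finsupp.single_eq_of_ne hij, add_zero] at hi
        refine hjm.trans (β.supp.min'_le i (MultiIdx.mem_supp.2 fun h0 => hi ?_))
        change β.1 i - _ = 0
        rw [h0, zero_tsub]
  · intro hn
    exfalso
    apply hn
    rw [Finset.mem_inter, MultiIdx.exponent_add]
    simp

theorem minCondition_iff_cycleCondition (hkl : k + l = n) (ω : MultiIdx r n → AltIdx k n → ℂ) :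
    MinCondition hkl ω ↔ CycleCondition ω :=
  ⟨cycleCondition_of_minCondition hkl, minCondition_of_cycleCondition hkl⟩

end Conditions

/-! ### Equivalence of the vanishing conditions. -/

section Equivalence

variable {V : Type*} [AddCommGroup V] [Module ℝ V] {n : ℕ}

theorem bubbleSum_eq_zero_of_cycleCondition (T : Affine.Simplex ℝ V n) {r k : ℕ}
    {ω : MultiIdx r n → AltIdx k n → ℂ} (h : CycleCondition ω) : bubbleSum T ω = 0 := by
  rw [bubbleSum_eq_polyForm]
  refine polyForm_eq_zero T fun θ hθ => ?_
  rw [kos_unitOp_bubbleCoef, (cycleCondition_iff ω).1 h ⟨θ, hθ⟩, mul_zero]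

theorem whitneySum_eq_zero_of_cycleCondition (T : Affine.Simplex ℝ V n) {r k l : ℕ}
    (hkl : k + l = n) {ω : MultiIdx r n → AltIdx k n → ℂ} (h : CycleCondition ω) :
    whitneySum T hkl ω = 0 := by
  rw [whitneySum_eq_polyForm]
  funext x
  rw [polyForm, altSum, Pi.zero_apply]
  refine Finset.sum_eq_zero fun t _ => ?_
  by_cases ht : t.card = l
  · have hc : tᶜ.card = k + 1 := by
      rw [Finset.card_compl, Fintype.card_fin]
      omega
    rw [whitneyCoef, (cycleCondition_iff ω).1 h ⟨tᶜ, hc⟩, smul_zero, map_zero, zero_smul]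
  · rw [dl_of_card_ne T ht, smul_zero]

theorem tfae_conditions (T : Affine.Simplex ℝ V n) {r k l : ℕ} (hkl : k + l = n)
    (ω : MultiIdx r n → AltIdx k n → ℂ) :
    List.TFAE [pairingSum T hkl ω = 0, whitneySum T hkl ω = 0, bubbleSum T ω = 0,
      MinCondition hkl ω, CycleCondition ω] := by
  have hpair (η : MultiIdx r n → AltIdx k n → ℂ) (h : pairingSum T hkl η = 0) :
      CycleCondition η :=
    (cycleCondition_iff η).2 (kos_eq_zero_of_pairingSum_eq_zero T hkl η h)
  tfae_have 1 → 5 := hpair ω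
  tfae_have 5 → 2 := whitneySum_eq_zero_of_cycleCondition T hkl
  tfae_have 5 → 3 := bubbleSum_eq_zero_of_cycleCondition T
  tfae_have 4 ↔ 5 := minCondition_iff_cycleCondition hkl ω
  tfae_have 3 → 1 := fun h => by
    have h' : bubbleLin T r k ω = 0 := Subtype.ext h
    rw [pairingSum_eq_polyPairing, h', map_zero, LinearMap.zero_apply]
  -- In the pairing the Whitney factor carries conjugated coefficients, so the pairing is applied to
  -- the conjugate family to make the given Whitney sum appear.
  tfae_have 2 → 5 := fun h => by
    have h' : whitneyLin T r hkl ω = 0 := Subtype.ext h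
    refine cycleCondition_conjCoef (hpair _ ?_)
    rw [pairingSum_eq_polyPairing, conjCoef_conjCoef, h', map_zero]
  tfae_finish

end Equivalence

/-! ### Exactness of the Koszul complex -/

section Exactness

open MvPolynomial

variable {n : ℕ}

theorem prod_X_eq_monomial {ι : Type*} [DecidableEq ι] (s : Finset ι) :
    (∏ i ∈ s, X i : MvPolynomial ι ℂ) = monomial (∑ i ∈ s, Finsupp.single i 1) 1 := by
  rw [monomial_sum_one]
  rfl

theorem prod_X_ne_zero {ι : Type*} (s : Finset ι) : (∏ i ∈ s, X i : MvPolynomial ι ℂ) ≠ 0 :=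
  Finset.prod_ne_zero_iff.2 fun i _ => X_ne_zero i

theorem prod_X_dvd {ι : Type*} {s : Finset ι} {Q : MvPolynomial ι ℂ} (h : ∀ i ∈ s, X i ∣ Q) :
    ∏ i ∈ s, X i ∣ Q := by
  refine Finset.prod_dvd_of_isRelPrime (fun i _ j _ hij => ?_) h
  exact X_prime.irreducible.isRelPrime_iff_not_dvd.2 fun h => hij (X_dvd_X.1 h)

theorem isHomogeneous_of_prod_X_mul {ι : Type*} [DecidableEq ι] {s : Finset ι}
    {G : MvPolynomial ι ℂ} {m : ℕ} (h : ((∏ i ∈ s, X i) * G).IsHomogeneous (s.card + m)) :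
    G.IsHomogeneous m := by
  intro d hd
  rw [prod_X_eq_monomial] at h
  have hc : coeff (∑ i ∈ s, Finsupp.single i 1 + d)
      (monomial (∑ i ∈ s, Finsupp.single i 1) 1 * G) ≠ 0 := by
    rwa [coeff_monomial_mul, one_mul]
  have h1 : (∑ i ∈ s, Finsupp.single i 1 + d).degree = s.card + m := by
    by_contra h'
    exact hc (h.coeff_eq_zero h')
  rw [map_add, map_sum] at h1
  simp only [Finsupp.degree_single, Finset.sum_const, smul_eq_mul, mul_one] at h1
  have h2 : d.degree = m := by omega
  rw [← h2, Finsupp.degree_eq_weight_one]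
  rfl

/-- The partial derivatives as additive maps. -/
noncomputable def derivOp (n : ℕ) :
    Fin (n + 1) → MvPolynomial (Fin (n + 1)) ℂ →+ MvPolynomial (Fin (n + 1)) ℂ :=
  fun p => (pderiv p : Derivation ℂ (MvPolynomial (Fin (n + 1)) ℂ)
    (MvPolynomial (Fin (n + 1)) ℂ)).toLinearMap.toAddMonoidHom

theorem derivOp_apply (p : Fin (n + 1)) (Q : MvPolynomial (Fin (n + 1)) ℂ) :
    derivOp n p Q = pderiv p Q := rfl

theorem mulX_apply (p : Fin (n + 1)) (Q : MvPolynomial (Fin (n + 1)) ℂ) :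
    mulX n p Q = X p * Q := rfl

/-- Euler's identity accounts for $m$; each index outside $\theta$ adds one more copy of $Q$ because
$\partial_p(X_pQ)=Q+X_p\partial_pQ$. -/
theorem sum_mulX_derivOp {m : ℕ} {Q : MvPolynomial (Fin (n + 1)) ℂ} (hQ : Q.IsHomogeneous m)
    (θ : Finset (Fin (n + 1))) :
    ∑ p ∈ θ, mulX n p (derivOp n p Q) + ∑ p ∈ θᶜ, derivOp n p (mulX n p Q) =
      (m + θᶜ.card) • Q := by
  simp only [derivOp_apply, mulX_apply, pderiv_mul, pderiv_X_self, one_mul,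
    Finset.sum_add_distrib, Finset.sum_const]
  rw [add_left_comm, Finset.sum_add_sum_compl, hQ.sum_X_mul_pderiv, add_smul]
  exact add_comm _ _

/-- Exactness of the polynomial Koszul complex in positive degree: on a cycle, contraction by
partial derivatives followed by $K$ is multiplication by a number, so the rescaled contraction is a
primitive. -/
theorem exists_kos_mulX_eq {m j : ℕ} {G : Finset (Fin (n + 1)) → MvPolynomial (Fin (n + 1)) ℂ}
    (hG : ∀ s, (G s).IsHomogeneous (m + 1))
    (h : ∀ ψ : Finset (Fin (n + 1)), ψ.card = j + 1 → kos (mulX n) G ψ = 0) :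
    ∃ a : Finset (Fin (n + 1)) → MvPolynomial (Fin (n + 1)) ℂ, (∀ s, (a s).IsHomogeneous m) ∧
      ∀ θ : Finset (Fin (n + 1)), θ.card = j → kos (mulX n) a θ = G θ := by
  -- The Euler factor: polynomial degree $m+1$ plus $|\theta^c|=n+1-j$. The degree being positive
  -- keeps it nonzero even for the full index set.
  set N : ℂ := ((m + 1 + (n + 1 - j) : ℕ) : ℂ) with hN
  have hN0 : N ≠ 0 := by
    rw [hN, Nat.cast_ne_zero]
    omega
  refine ⟨fun s => C N⁻¹ * con (derivOp n) G s, fun s => ?_, fun θ hθ => ?_⟩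
  · refine IsHomogeneous.C_mul (IsHomogeneous.sum _ _ _ fun p _ => ?_) _
    rw [← mem_homogeneousSubmodule]
    exact zsmul_mem ((hG _).pderiv (i := p)) _
  have h1 := kos_con_add_con_kos (mulX n) (derivOp n) (fun p q hpq x => by
    rw [mulX_apply, mulX_apply, derivOp_apply, derivOp_apply, pderiv_mul, pderiv_X_of_ne hpq, zero_mul, zero_add]) G θ
  have h2 : con (derivOp n) (kos (mulX n) G) θ = 0 := by
    refine Finset.sum_eq_zero fun p hp => ?_
    rw [h _ (by rw [Finset.card_insert_of_notMem (Finset.mem_compl.1 hp), hθ]), map_zero,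
      smul_zero]
  have h3 : (m + 1 + θᶜ.card) • G θ = C N * G θ := by
    rw [Finset.card_compl, Fintype.card_fin, hθ, hN, nsmul_eq_mul, map_natCast]
  rw [h2, add_zero, sum_mulX_derivOp (hG θ), h3] at h1
  have h5 : kos (mulX n) (fun s => C N⁻¹ * con (derivOp n) G s) θ =
      C N⁻¹ * kos (mulX n) (con (derivOp n) G) θ := by
    rw [kos, kos, Finset.mul_sum]
    refine Finset.sum_congr rfl fun p _ => ?_
    simp only [AddMonoidHom.coe_mulLeft]
    rw [mul_smul_comm, mul_left_comm]
  rw [h5, h1, ← mul_assoc, ← C_mul, inv_mul_cancel₀ hN0, C_1, one_mul]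

/-- A family of polynomials whose image under `∑ e_p ∧ ·` vanishes on all facets is, up to
multiples of `∑ e_p`, a family of bubble coefficients. -/
theorem exists_bubbleCoef {r k l : ℕ} (hkl : k + l = n)
    {c : Finset (Fin (n + 1)) → MvPolynomial (Fin (n + 1)) ℂ}
    (hc : ∀ s, (c s).IsHomogeneous (r + l + 1))
    (hdvd : ∀ θ : Finset (Fin (n + 1)), θ.card = k + 1 → ∀ i ∉ θ,
      X i ∣ kos (unitOp _ _) c θ) :
    ∃ a : Finset (Fin (n + 1)) → MvPolynomial (Fin (n + 1)) ℂ, (∀ s, (a s).IsHomogeneous r) ∧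
      ∀ θ : Finset (Fin (n + 1)), θ.card = k + 1 →
        kos (unitOp _ _) (bubbleCoef a) θ = kos (unitOp _ _) c θ := by
  have hG : ∀ θ : Finset (Fin (n + 1)), ∃ G : MvPolynomial (Fin (n + 1)) ℂ,
      G.IsHomogeneous (r + 1) ∧
        (θ.card = k + 1 → kos (unitOp _ _) c θ = (∏ i ∈ θᶜ, X i) * G) := by
    intro θ
    by_cases hθ : θ.card = k + 1
    · obtain ⟨G, hG⟩ := prod_X_dvd (s := θᶜ) fun i hi => hdvd θ hθ i (Finset.mem_compl.1 hi)
      refine ⟨G, isHomogeneous_of_prod_X_mul (s := θᶜ) ?_, fun _ => hG⟩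
      rw [← hG]
      -- Since $|\theta|=k+1$, the monomial $X_{\theta^c}$ has degree $l$, which leaves degree $r+1$
      -- for the quotient.
      have hcard : θᶜ.card + (r + 1) = r + l + 1 := by
        rw [Finset.card_compl, Fintype.card_fin]
        omega
      rw [hcard]
      refine IsHomogeneous.sum _ _ _ fun p _ => ?_
      rw [← mem_homogeneousSubmodule]
      exact zsmul_mem (hc _) _
    · exact ⟨0, isHomogeneous_zero _ _ _, fun h => absurd h hθ⟩
  choose G hGh hGe using hG
  have hK : ∀ ψ : Finset (Fin (n + 1)), ψ.card = k + 1 + 1 → kos (mulX n) G ψ = 0 := by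
    intro ψ hψ
    -- The products $X_{\theta^c}G_\theta$ are in the image of $K_1$, so $K_1$ kills them;
    -- cancelling the monomial $X_{\psi^c}$ leaves $KG=0$.
    have h1 := kos_unitOp_bubbleCoef G ψ
    rw [kos_congr (unitOp _ _) (b := bubbleCoef G) (c := kos (unitOp _ _) c)
      (fun s hs => (hGe s hs).symm) hψ, kos_kos _ fun _ _ _ => rfl] at h1
    exact (mul_eq_zero.1 h1.symm).resolve_left (prod_X_ne_zero _)
  obtain ⟨a, ha, hak⟩ := exists_kos_mulX_eq hGh hK
  refine ⟨a, ha, fun θ hθ => ?_⟩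
  rw [kos_unitOp_bubbleCoef, hak θ hθ, hGe θ hθ]

theorem exists_coefPoly_eq {r k : ℕ} {a : Finset (Fin (n + 1)) → MvPolynomial (Fin (n + 1)) ℂ}
    (ha : ∀ s, (a s).IsHomogeneous r) :
    ∃ ω : MultiIdx r n → AltIdx k n → ℂ, ∀ s : Finset (Fin (n + 1)), s.card = k →
      coefPoly ω s = a s := by
  refine ⟨fun α σ => coeff α.exponent (a σ.1), fun s hs => ?_⟩
  ext d
  by_cases hd : d.degree = r
  · obtain ⟨α, rfl⟩ := MultiIdx.exists_exponent_eq hd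
    exact coeff_coefPoly _ α ⟨s, hs⟩
  · rw [(ha s).coeff_eq_zero hd, (isHomogeneous_coefPoly _ s).coeff_eq_zero hd]

end Exactness

/-! ### Traces and the form spaces -/

section Traces

open MvPolynomial

variable {V : Type*} [AddCommGroup V] [Module ℝ V] {n : ℕ}

/-- The tangent space of the face is spanned by differences of its vertices, and $\lambda_j$ is zero
at all of them. -/
theorem dcov_face (T : Affine.Simplex ℝ V n) {m : ℕ} {fs : Finset (Fin (n + 1))}
    (h : fs.card = m + 1) {j : Fin (n + 1)} (hj : j ∉ fs) {u : V} (hu : u ∈ Tangent (T.face h))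
    (hu' : u ∈ Tangent T) : ((vertexBasis T).coord j).linear ⟨u, hu'⟩ = 0 := by
  have hle : Tangent (T.face h) ≤
      (LinearMap.ker ((vertexBasis T).coord j).linear).map (Tangent T).subtype := by
    rw [Tangent, direction_affineSpan, vectorSpan_def, Submodule.span_le]
    rintro _ ⟨a, ha, b, hb, rfl⟩
    rw [Affine.Simplex.range_face_points] at ha hb
    obtain ⟨a, ha, rfl⟩ := ha
    obtain ⟨b, hb, rfl⟩ := hb
    refine ⟨vec T b a, ?_, rfl⟩
    rw [SetLike.mem_coe, LinearMap.mem_ker, coord_linear_vec, if_neg, if_neg, sub_zero]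
    · rintro rfl
      exact hj hb
    · rintro rfl
      exact hj ha
  obtain ⟨v, hv, hvu⟩ := hle hu
  have : v = ⟨u, hu'⟩ := Subtype.ext hvu
  rw [← this]
  exact hv

theorem lam_face (T : Affine.Simplex ℝ V n) {m : ℕ} {fs : Finset (Fin (n + 1))}
    (h : fs.card = m + 1) {j : Fin (n + 1)} (hj : j ∉ fs) (x : Carrier (T.face h))
    (hx : x.1 ∈ Carrier T) : lam T j ⟨x.1, hx⟩ = 0 := by
  obtain ⟨q, hq⟩ : fs.Nonempty := Finset.card_pos.1 (by omega)
  have hqm : T.points q ∈ Hull (T.face h) :=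
    mem_affineSpan ℝ (by rw [Affine.Simplex.range_face_points]; exact ⟨q, hq, rfl⟩)
  have hu : x.1 -ᵥ T.points q ∈ Tangent (T.face h) :=
    AffineSubspace.vsub_mem_direction (convexHull_subset_affineSpan _ x.2) hqm
  have hu' := AffineSubspace.direction_le (affineSpan_mono ℝ (face_range_subset T h)) hu
  have he : toHull T ⟨x.1, hx⟩ = (⟨_, hu'⟩ : Tangent T) +ᵥ vertexBasis T q := by
    refine Subtype.ext ?_
    change x.1 = (x.1 - T.points q) + T.points q
    rw [sub_add_cancel]
  rw [lam, he, AffineMap.map_vadd, dcov_face T h hj hu hu', AffineBasis.coord_apply, if_neg]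
  · simp
  · rintro rfl
    exact hj hq

/-- A proper face misses some vertex $j$. Either $j\in[\sigma]$ and the factor $d\lambda_j$
restricts to zero, or $j\in[\sigma^c]$ and the factor $\lambda_j$ of $\lambda_{\sigma^c}$ does. -/
theorem trace_bubble_eq_zero (T : Affine.Simplex ℝ V n) {k m : ℕ} {fs : Finset (Fin (n + 1))}
    (h : fs.card = m + 1) (hfs : fs ≠ Finset.univ) (f : Carrier T → ℝ) (σ : AltIdx k n) :
    trace T h (fmul f (fmul (lamProd T σ.1ᶜ) (dlamAlt T σ))) = 0 := by
  obtain ⟨j, hj⟩ : ∃ j, j ∉ fs := by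
    by_contra! h'
    exact hfs (Finset.eq_univ_iff_forall.2 h')
  funext x
  ext v
  set y : Carrier T := ⟨x.1, convexHull_mono (face_range_subset T h) x.2⟩ with hy
  set u : Fin k → Tangent T := fun i => Submodule.inclusion
    (AffineSubspace.direction_le (affineSpan_mono ℝ (face_range_subset T h))) (v i) with hu
  change f y • lamProd T σ.1ᶜ y • dlamAlt T σ y u = 0
  by_cases hjσ : j ∈ σ.1
  · have : dlamAlt T σ y u = 0 := by
      rw [dlamAlt_eq_dl, dl_of_card T σ.2, detForm_apply]
      obtain ⟨i, hi⟩ : j ∈ Set.range (σ.1.orderEmbOfFin σ.2) := by simpa using hjσ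
      refine Matrix.det_eq_zero_of_column_eq_zero i fun a => ?_
      rw [Matrix.of_apply, hi]
      change ((((vertexBasis T).coord j).linear (u a) : ℝ) : ℂ) = 0
      rw [Complex.ofReal_eq_zero]
      exact dcov_face T h hj (v a).2 _
    rw [this, smul_zero, smul_zero]
  · have : lamProd T σ.1ᶜ y = 0 :=
      Finset.prod_eq_zero (Finset.mem_compl.2 hjσ) (lam_face T h hj x _)
    rw [this, zero_smul, smul_zero]

/-- The trace as a linear map. -/
noncomputable def traceLin (T : Affine.Simplex ℝ V n) (k : ℕ) {m : ℕ} {fs : Finset (Fin (n + 1))}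
    (h : fs.card = m + 1) : Form T k →ₗ[ℂ] Form (T.face h) k where
  toFun := trace T h
  map_add' _ _ := rfl
  map_smul' _ _ := rfl

theorem trace_bubbleSum (T : Affine.Simplex ℝ V n) {r k m : ℕ} {fs : Finset (Fin (n + 1))}
    (h : fs.card = m + 1) (hfs : fs ≠ Finset.univ) (ω : MultiIdx r n → AltIdx k n → ℂ) :
    trace T h (bubbleSum T ω) = 0 := by
  change traceLin T k h (bubbleSum T ω) = 0
  rw [bubbleSum, map_sum]
  refine Finset.sum_eq_zero fun α _ => ?_
  rw [map_sum]
  refine Finset.sum_eq_zero fun σ _ => ?_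
  rw [map_smul]
  exact (congrArg _ (trace_bubble_eq_zero T h hfs _ σ)).trans (smul_zero _)

theorem bubbleSum_mem_polyForms (T : Affine.Simplex ℝ V n) {r k l : ℕ} (hkl : k + l = n)
    (ω : MultiIdx r n → AltIdx k n → ℂ) : bubbleSum T ω ∈ polyForms T (r + l + 1) k := by
  refine Submodule.sum_mem _ fun α _ => Submodule.sum_mem _ fun σ _ =>
    Submodule.smul_mem _ _ (Submodule.subset_span ?_)
  -- The exponent of $\lambda^\alpha\lambda_{\sigma^c}$, of degree $r+(l+1)$.
  refine ⟨⟨fun i => α.1 i + if i ∈ σ.1ᶜ then 1 else 0, ?_⟩, σ, ?_⟩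
  · rw [Finset.sum_add_distrib, α.2, Finset.sum_ite_mem, Finset.univ_inter, Finset.sum_const,
      smul_eq_mul, mul_one, Finset.card_compl, Fintype.card_fin, σ.2]
    omega
  · funext x
    simp only [fmul, lamPow, lamProd, smul_smul]
    congr 1
    simp only [pow_add, Finset.prod_mul_distrib]
    congr 1
    rw [← Finset.prod_subset (Finset.subset_univ σ.1ᶜ)]
    · refine Finset.prod_congr rfl fun i hi => ?_
      rw [if_pos hi, pow_one]
    · intro i _ hi
      rw [if_neg hi, pow_zero]

theorem bubbleSum_mem_polyForms₀ (T : Affine.Simplex ℝ V n) {r k l : ℕ} (hkl : k + l = n)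
    (ω : MultiIdx r n → AltIdx k n → ℂ) : bubbleSum T ω ∈ polyForms₀ T (r + l + 1) k :=
  ⟨bubbleSum_mem_polyForms T hkl ω, fun _ _ h hfs => trace_bubbleSum T h hfs ω⟩

/-! ### Every form of the two spaces comes from a coefficient family. -/

theorem exists_polyForm_of_mem_polyForms (T : Affine.Simplex ℝ V n) {s k : ℕ} {η : Form T k}
    (h : η ∈ polyForms T s k) :
    ∃ c : Finset (Fin (n + 1)) → MvPolynomial (Fin (n + 1)) ℂ,
      (∀ t, (c t).IsHomogeneous s) ∧ polyForm T k c = η := by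
  induction h using Submodule.span_induction with
  | mem η h =>
    obtain ⟨α, σ, rfl⟩ := h
    refine ⟨Pi.single σ.1 (monomial α.exponent 1), fun t => ?_, ?_⟩
    · by_cases ht : t = σ.1
      · subst ht
        rw [Pi.single_eq_same]
        refine isHomogeneous_monomial _ ?_
        rw [Finsupp.degree_eq_sum]
        exact α.2
      · rw [Pi.single_eq_of_ne ht]
        exact isHomogeneous_zero _ _ _
    · funext x
      ext v
      rw [polyForm, altSum_apply, Finset.sum_eq_single σ.1]
      · rw [Pi.single_eq_same, eval_monomial_exponent, one_mul, ← dlamAlt_eq_dl T σ x,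
          ← Complex.real_smul]
        rfl
      · intro t _ ht
        rw [Pi.single_eq_of_ne ht, map_zero, zero_mul]
      · simp
  | zero => exact ⟨0, fun t => isHomogeneous_zero _ _ _, map_zero (polyFormLin T k)⟩
  | add η ζ _ _ h₁ h₂ =>
    obtain ⟨c, hc, rfl⟩ := h₁
    obtain ⟨d, hd, rfl⟩ := h₂
    exact ⟨c + d, fun t => (hc t).add (hd t), map_add (polyFormLin T k) c d⟩
  | smul z η _ h =>
    obtain ⟨c, hc, rfl⟩ := h
    refine ⟨z • c, fun t => ?_, map_smul (polyFormLin T k) z c⟩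
    rw [← mem_homogeneousSubmodule]
    exact Submodule.smul_mem _ _ (hc t)

/-- The form evaluated on the edges of a subsimplex vanishes with its trace. -/
theorem apply_vec_eq_zero_of_trace (T : Affine.Simplex ℝ V n) {k m : ℕ}
    {fs : Finset (Fin (n + 1))} (h : fs.card = m + 1) {η : Form T k} (hη : trace T h η = 0)
    {x : Carrier T} (hx : x.1 ∈ Carrier (T.face h)) {q : Fin (n + 1)} (hq : q ∈ fs)
    {t : Fin k → Fin (n + 1)} (ht : ∀ i, t i ∈ fs) : η x (fun i => vec T q (t i)) = 0 := by
  have hmem : ∀ i ∈ fs, T.points i ∈ Hull (T.face h) := fun i hi =>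
    mem_affineSpan ℝ (by rw [Affine.Simplex.range_face_points]; exact ⟨i, hi, rfl⟩)
  have h1 := congrFun hη ⟨x.1, hx⟩
  exact DFunLike.congr_fun h1 fun i => (⟨T.points (t i) - T.points q,
    AffineSubspace.vsub_mem_direction (hmem _ (ht i)) (hmem _ hq)⟩ : Tangent (T.face h))

/-- For $i\notin\theta$ the edges of $\theta$ are tangent to the facet $\lambda_i=0$, where the
trace vanishes. The entry at $\theta$ is a value on these edges (`altSum_vec`), so it vanishes on
that facet. -/
theorem X_dvd_kos_of_mem_polyForms₀ (T : Affine.Simplex ℝ V n) {s k : ℕ}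
    {c : Finset (Fin (n + 1)) → MvPolynomial (Fin (n + 1)) ℂ} (hc : ∀ t, (c t).IsHomogeneous s)
    (h : polyForm T k c ∈ polyForms₀ T s k) {θ : Finset (Fin (n + 1))} (hθ : θ.card = k + 1)
    {i : Fin (n + 1)} (hi : i ∉ θ) : X i ∣ kos (unitOp _ _) c θ := by
  obtain ⟨q, hq⟩ : θ.Nonempty := Finset.card_pos.1 (by omega)
  have hqi : q ≠ i := fun h => hi (h ▸ hq)
  have hhom : (kos (unitOp _ _) c θ).IsHomogeneous s := by
    refine IsHomogeneous.sum _ _ _ fun p _ => ?_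
    rw [← mem_homogeneousSubmodule]
    exact zsmul_mem (hc _) _
  refine X_dvd_of_eval_facet hhom hqi fun w hw hwi hws => ?_
  obtain ⟨x, hx, hxe⟩ := exists_lam_eq T w hw hws
  have hcard : (Finset.univ.erase i).card = (n - 1) + 1 := by
    rw [Finset.card_erase_of_mem (Finset.mem_univ i), Finset.card_univ, Fintype.card_fin]
    have : n ≠ 0 := by
      rintro rfl
      exact hqi (Fin.ext (by omega))
    omega
  have hxf : x.1 ∈ Carrier (T.face hcard) := by
    rw [hxe, ← Finset.add_sum_erase _ _ (Finset.mem_univ i), hwi, zero_smul, zero_add]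
    refine (convex_convexHull ℝ _).sum_mem (fun j _ => hw j) ?_ fun j hj => ?_
    · rw [← hws, ← Finset.add_sum_erase _ _ (Finset.mem_univ i), hwi, zero_add]
    · refine subset_convexHull ℝ _ ?_
      rw [Affine.Simplex.range_face_points]
      exact ⟨j, hj, rfl⟩
  have hτ : (θ.erase q).card = k := by
    rw [Finset.card_erase_of_mem hq, hθ]
    rfl
  have h0 := apply_vec_eq_zero_of_trace T hcard
    (h.2 _ _ hcard (fun h' => Finset.notMem_erase i _ (h' ▸ Finset.mem_univ i))) hxf
    (q := q) (t := (θ.erase q).orderEmbOfFin hτ) (by simp [hqi]) fun j => by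
      have := Finset.orderEmbOfFin_mem _ hτ j
      rw [Finset.mem_erase] at this
      rw [Finset.mem_erase]
      exact ⟨fun h' => hi (h' ▸ this.2), Finset.mem_univ _⟩
  rw [polyForm, altSum_vec T _ hτ (Finset.notMem_erase q θ), Finset.insert_erase hq,
    eval_kos_unitOp, zsmul_eq_mul] at h0
  have hpt : pt T x = fun j => (w j : ℂ) := by
    ext j
    rw [pt, hx]
  rw [hpt] at h0
  refine (mul_eq_zero.1 h0).resolve_left fun h' => ?_
  have := sg_mul_self q (θ.erase q)
  rw [Int.cast_eq_zero.1 h'] at this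
  simp at this

/-- The bubble family is constructed only to have the same image under $K_1$ as $c$; this is enough,
because $K_1$ of the difference vanishes and `polyForm_eq_zero` applies. -/
theorem exists_bubbleSum_of_mem_polyForms₀ (T : Affine.Simplex ℝ V n) {r k l : ℕ}
    (hkl : k + l = n) {η : Form T k} (h : η ∈ polyForms₀ T (r + l + 1) k) :
    ∃ ω : MultiIdx r n → AltIdx k n → ℂ, bubbleSum T ω = η := by
  obtain ⟨c, hc, rfl⟩ := exists_polyForm_of_mem_polyForms T h.1
  obtain ⟨a, ha, hak⟩ := exists_bubbleCoef hkl hc fun θ hθ i hi =>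
    X_dvd_kos_of_mem_polyForms₀ T hc h hθ hi
  obtain ⟨ω, hω⟩ := exists_coefPoly_eq (k := k) ha
  refine ⟨ω, ?_⟩
  rw [bubbleSum_eq_polyForm, ← sub_eq_zero]
  refine (map_sub (polyFormLin T k) _ _).symm.trans (polyForm_eq_zero T fun θ hθ => ?_)
  rw [kos_sub, Pi.sub_apply, ← hak θ hθ, sub_eq_zero]
  exact kos_congr _ (fun s hs => by rw [bubbleCoef, bubbleCoef, hω s hs]) hθ

theorem whitneySum_mem_whitneyForms (T : Affine.Simplex ℝ V n) {r k l : ℕ} (hkl : k + l = n)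
    (ω : MultiIdx r n → AltIdx k n → ℂ) : whitneySum T hkl ω ∈ whitneyForms T (r + 1) l :=
  Submodule.sum_mem _ fun α _ => Submodule.sum_mem _ fun σ _ =>
    Submodule.smul_mem _ _ (Submodule.subset_span ⟨r, rfl, α, σ.compl hkl, rfl⟩)

theorem exists_whitneySum_of_mem_whitneyForms (T : Affine.Simplex ℝ V n) {r k l : ℕ}
    (hkl : k + l = n) {η : Form T l} (h : η ∈ whitneyForms T (r + 1) l) :
    ∃ ω : MultiIdx r n → AltIdx k n → ℂ, whitneySum T hkl ω = η := by
  have hadd : ∀ ω ζ : MultiIdx r n → AltIdx k n → ℂ,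
      whitneySum T hkl (ω + ζ) = whitneySum T hkl ω + whitneySum T hkl ζ := fun ω ζ =>
    congrArg Subtype.val (map_add (whitneyLin T r hkl) ω ζ)
  have hsmul : ∀ (z : ℂ) (ω : MultiIdx r n → AltIdx k n → ℂ),
      whitneySum T hkl (z • ω) = z • whitneySum T hkl ω := fun z ω =>
    congrArg Subtype.val (map_smul (whitneyLin T r hkl) z ω)
  induction h using Submodule.span_induction with
  | mem η h =>
    obtain ⟨s, hs, α, ρ, rfl⟩ := h
    obtain rfl : s = r := by omega
    have hc : (ρ.1ᶜ).card = k := by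
      rw [Finset.card_compl, Fintype.card_fin, ρ.2]
      omega
    -- The coefficient cancels the sign built into `whitneySum`, as $\epsilon(\rho^c,\rho)^2=1$.
    refine ⟨singleCoef α ⟨ρ.1ᶜ, hc⟩ (eps ρ.1ᶜ ρ.1 : ℂ), ?_⟩
    have hρ : AltIdx.compl hkl (⟨ρ.1ᶜ, hc⟩ : AltIdx k n) = ρ := Subtype.ext (compl_compl _)
    rw [whitneySum_singleCoef, hρ, compl_compl, ← Int.cast_mul,
      eps_mul_self disjoint_compl_left, Int.cast_one, one_smul]
  | zero => exact ⟨0, congrArg Subtype.val (map_zero (whitneyLin T r hkl))⟩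
  | add η ζ _ _ h₁ h₂ =>
    obtain ⟨c, rfl⟩ := h₁
    obtain ⟨d, rfl⟩ := h₂
    exact ⟨c + d, hadd c d⟩
  | smul z η _ h =>
    obtain ⟨c, rfl⟩ := h
    exact ⟨z • c, hsmul z c⟩

/-- Both spaces are parametrized by the same coefficient families. A form orthogonal to the whole
other space is orthogonal to its conjugate partner, and the definiteness of the sum of squares
forces it to vanish. -/
theorem exists_nondegenerate_pairing (T : Affine.Simplex ℝ V n) (r : ℕ) {k l : ℕ}
    (hkl : k + l = n) :
    ∃ B : polyForms₀ T (r + l + 1) k →ₗ[ℂ] whitneyForms T (r + 1) l →ₗ[ℂ] ℂ,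
      (∀ ω η, B ω η = integral T hkl (wedge ω.1 η.1)) ∧ B.Nondegenerate := by
  have hle₁ : polyForms₀ T (r + l + 1) k ≤ LinearMap.range (polyFormLin T k) := fun η h => by
    obtain ⟨ω, rfl⟩ := exists_bubbleSum_of_mem_polyForms₀ T hkl h
    exact (bubbleLin T r k ω).2
  have hle₂ : whitneyForms T (r + 1) l ≤ LinearMap.range (polyFormLin T l) := fun η h => by
    obtain ⟨ω, rfl⟩ := exists_whitneySum_of_mem_whitneyForms T hkl h
    exact (whitneyLin T r hkl ω).2
  have hpair (ω : MultiIdx r n → AltIdx k n → ℂ) : pairingSum T hkl ω =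
      integral T hkl (wedge (bubbleSum T ω) (whitneySum T hkl (conjCoef ω))) :=
    pairingSum_eq_polyPairing T hkl ω
  refine ⟨(polyPairing T hkl).compl₁₂ (Submodule.inclusion hle₁) (Submodule.inclusion hle₂),
    fun _ _ => rfl, ?_, ?_⟩
  · rintro ⟨η, hη⟩ h
    obtain ⟨ω, rfl⟩ := exists_bubbleSum_of_mem_polyForms₀ T hkl hη
    have h1 := h ⟨_, whitneySum_mem_whitneyForms T hkl (conjCoef ω)⟩
    exact Subtype.ext (((tfae_conditions T hkl ω).out 0 2).1 ((hpair ω).trans h1))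
  · rintro ⟨η, hη⟩ h
    obtain ⟨ω, rfl⟩ := exists_whitneySum_of_mem_whitneyForms T hkl hη
    have h1 := h ⟨_, bubbleSum_mem_polyForms₀ T hkl (conjCoef ω)⟩
    have h2 := hpair (conjCoef ω)
    rw [conjCoef_conjCoef] at h2
    have h3 := ((tfae_conditions T hkl (conjCoef ω)).out 0 4).1 (h2.trans h1)
    exact Subtype.ext (whitneySum_eq_zero_of_cycleCondition T hkl (cycleCondition_conjCoef h3))

end Traces

end BaryForms

theorem mainTheorem7 {V : Type*} [NormedAddCommGroup V] [InnerProductSpace ℝ V]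
    [FiniteDimensional ℝ V] {n : ℕ} (T : Affine.Simplex ℝ V n)
    (r k l : ℕ) (hkl : k + l = n) :
    (∀ ω : BaryForms.MultiIdx r n → BaryForms.AltIdx k n → ℂ,
      BaryForms.pairingSum T hkl ω =
        (-1) ^ k * ∑ θ : BaryForms.AltIdx (k + 1) n,
          BaryForms.integral T rfl
            (BaryForms.fmul
              (fun x => BaryForms.lamProd T θ.1ᶜ x * ‖BaryForms.thetaSum T ω θ x‖ ^ 2)
              (BaryForms.whitneyTop T)) ∧
      List.TFAE
        [ BaryForms.pairingSum T hkl ω = 0,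
          BaryForms.whitneySum T hkl ω = 0,
          BaryForms.bubbleSum T ω = 0,
          BaryForms.MinCondition hkl ω,
          BaryForms.CycleCondition ω ]) ∧
    ∃ B : BaryForms.polyForms₀ T (r + l + 1) k →ₗ[ℂ]
        BaryForms.whitneyForms T (r + 1) l →ₗ[ℂ] ℂ,
      (∀ ω η, B ω η = BaryForms.integral T hkl (BaryForms.wedge ω.1 η.1)) ∧
      B.Nondegenerate := by
  refine ⟨fun ω => ⟨?_, BaryForms.tfae_conditions T hkl ω⟩,
    BaryForms.exists_nondegenerate_pairing T r hkl⟩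
  rw [BaryForms.pairingSum_eq]
  simp only [BaryForms.integral_fmul_whitneyTop]
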